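/- Let $H\neq 0$ be a complex Hilbert space (for instance $H=L^2(\Gamma,\mathbb C^r)$). The self-adjoint Grassmannian is the space $\mathcal M'$ of all unitary operators $U=\mathbb I+K$ of $H$ with $K$ Hilbert--Schmidt, with the topology of the Hilbert--Schmidt distance $\|U-V\|_2$. Its Cayley submanifold is $\mathcal C'_-=\{U\in\mathcal M' : -1\in\sigma(U)\}$. For $U=\mathbb I+K\in\mathcal M'$ let $$\textstyle\det' U=\prod_k\big((1+\lambda_k)e^{-\lambda_k}\big)^{d_k},$$ where $\lambda_k$ are the nonzero eigenvalues of $K$ and $d_k$ their multiplicities. The Maslov index $\nu_M(\gamma)$ of a continuous closed curve $\gamma:S^1\to\mathcal M'$ is the winding number around $0$ of $\det'\circ\gamma:S^1\to\mathbb C\setminus\{0\}$. The Cayley index $\nu_c(p)$ of a continuous curve $p:[0,1]\to\mathcal M'$ is the number, with multiplicities, of eigenvalues of $p(t)$ that cross $-1$ anticlockwise minus the number that cross $-1$ clockwise, as $t$ goes from $0$ to $1$. Precisely: choose $0=t_0\le\dots\le t_N=1$ and $\varepsilon_j\in(0,\pi)$ such that $e^{i(\pi\pm\varepsilon_j)}\notin\sigma(p(t))$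 for $t\in[t_j,t_{j+1}]$; with $k(U,\varepsilon)$ the number of eigenvalues of $U$ (with multiplicity) in $\{e^{i\theta}:\pi\le\theta<\pi+\varepsilon\}$, $$\nu_c(p)=\sum_{j<N}\big(k(p(t_{j+1}),\varepsilon_j)-k(p(t_j),\varepsilon_j)\big).$$ For a closed curve $\gamma$, $\nu_c(\gamma)=\nu_c(p)$ with $p(t)=\gamma(e^{2\pi i t})$. **Theorem.** (1) The product defining $\det'U$ converges for every $U\in\mathcal M'$. Along every continuous curve $[0,1]\to\mathcal M'$ the function $\det'$ has a continuous logarithm, and $\nu_c$ is well defined (the choices exist and do not matter). (2) For every continuous closed curve $\gamma$ in $\mathcal M'$, $\nu_M(\gamma)$ is well defined and $\nu_M(\gamma)=\nu_c(\gamma)$. If $\gamma(e^{i\theta})\in\mathcal C'_-$ for only finitely many $\theta\in[0,2\pi)$, then $\nu_c(\gamma)$ is the sum over these $\theta$ of the local crossing indices, i.e. of the number of eigenvalues of $\gamma$ on a short arc $\{e^{i\tau}:\pi\le\tau<\pi+\varepsilon\}$ shortly after $\theta$ minus that number shortly before $\theta$. (3) $\mathcal C'_-$ is dual to the Maslov class,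 which generates $H^1(\mathcal M';\mathbb Z)\cong\mathbb Z$. That is: the intersection number with $\mathcal C'_-$, $p\mapsto\nu_c(p)$, is an integral singular $1$-cocycle of $\mathcal M'$; $p\mapsto\int_p\alpha$, the variation along $p$ of $\frac1{2\pi}\arg\det'$, is a real singular $1$-cocycle; the class of the former is mapped to the class of the latter (the Maslov class) by $H^1(\mathcal M';\mathbb Z)\to H^1(\mathcal M';\mathbb R)$; and every class in $H^1(\mathcal M';\mathbb Z)$ is a unique integer multiple of the class of $p\mapsto\nu_c(p)$. -/

import Mathlib

open Topology Filter
open scoped unitInterval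

noncomputable section

/-! ### Degree-one singular cohomology -/

/-- The straight edge from the vertex `i` to the vertex `j` of the standard 2-simplex. -/
def simplexEdge (i j : Fin 3) : C(I, stdSimplex ℝ (Fin 3)) where
  toFun t := ⟨fun k => (1 - (t : ℝ)) * (if k = i then 1 else 0) + (t : ℝ) * (if k = j then 1 else 0),
    by
      refine ⟨fun k => ?_, ?_⟩
      · have h0 := t.2.1
        have h1 := t.2.2
        have h2 : 0 ≤ 1 - (t : ℝ) := by linarith
        positivity
      · simp [Finset.sum_add_distrib]⟩
  continuous_toFun := by
    refine Continuous.subtype_mk (continuous_pi fun k => ?_) _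
    fun_prop

/-- Singular 1-cocycles of `X` with values in `A`. A 1-cochain is a function on the singular
1-simplices `I → X`; it is a cocycle if its coboundary
`c (s|[1,2]) - c (s|[0,2]) + c (s|[0,1])` vanishes on all singular 2-simplices `s`. -/
def singularCocycles (X : Type*) [TopologicalSpace X] (A : Type*) [AddCommGroup A] :
    AddSubgroup (C(I, X) → A) where
  carrier := {c | ∀ s : C(stdSimplex ℝ (Fin 3), X),
    c (s.comp (simplexEdge 1 2)) - c (s.comp (simplexEdge 0 2))
      + c (s.comp (simplexEdge 0 1)) = 0}
  zero_mem' := by intro s; simp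
  add_mem' := by
    intro c d hc hd s
    have h := congrArg₂ (· + ·) (hc s) (hd s)
    simp only [add_zero] at h
    rw [← h]
    simp only [Pi.add_apply]
    abel
  neg_mem' := by
    intro c hc s
    have h := congrArg Neg.neg (hc s)
    rw [neg_zero] at h
    rw [← h]
    simp only [Pi.neg_apply]
    abel

lemma simplexEdge_zero (i j : Fin 3) :
    ((simplexEdge i j 0 : stdSimplex ℝ (Fin 3)) : Fin 3 → ℝ) = Pi.single i 1 := by
  ext k
  change (1 - ((0 : I) : ℝ)) * (if k = i then 1 else 0)
    + ((0 : I) : ℝ) * (if k = j then 1 else 0) = _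
  simp [Pi.single_apply]

lemma simplexEdge_one (i j : Fin 3) :
    ((simplexEdge i j 1 : stdSimplex ℝ (Fin 3)) : Fin 3 → ℝ) = Pi.single j 1 := by
  ext k
  change (1 - ((1 : I) : ℝ)) * (if k = i then 1 else 0)
    + ((1 : I) : ℝ) * (if k = j then 1 else 0) = _
  simp [Pi.single_apply]

/-- The coboundary of a 0-cochain `f : X → A`: its value on `p` is `f (p 1) - f (p 0)`. -/
def singularCoboundary (X : Type*) [TopologicalSpace X] (A : Type*) [AddCommGroup A] :
    (X → A) →+ singularCocycles X A where
  toFun f := ⟨fun p => f (p 1) - f (p 0), by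
    intro s
    have h1 : simplexEdge 0 1 1 = simplexEdge 1 2 0 :=
      Subtype.ext ((simplexEdge_one 0 1).trans (simplexEdge_zero 1 2).symm)
    have h2 : simplexEdge 0 2 1 = simplexEdge 1 2 1 :=
      Subtype.ext ((simplexEdge_one 0 2).trans (simplexEdge_one 1 2).symm)
    have h3 : simplexEdge 0 2 0 = simplexEdge 0 1 0 :=
      Subtype.ext ((simplexEdge_zero 0 2).trans (simplexEdge_zero 0 1).symm)
    simp only [ContinuousMap.comp_apply, h1, h2, h3]
    abel⟩
  map_zero' := by ext p; simp
  map_add' f g := by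
    ext p
    simp only [Pi.add_apply, AddSubgroup.coe_add]
    abel

/-- The first singular cohomology group `H¹(X; A)`. -/
abbrev SingularH1 (X : Type*) [TopologicalSpace X] (A : Type*) [AddCommGroup A] : Type _ :=
  singularCocycles X A ⧸ (singularCoboundary X A).range

/-- The class in `H¹(X; A)` of a singular 1-cocycle. -/
def singularClass {X : Type*} [TopologicalSpace X] {A : Type*} [AddCommGroup A]
    (c : C(I, X) → A) (hc : c ∈ singularCocycles X A) : SingularH1 X A :=
  QuotientAddGroup.mk ⟨c, hc⟩

/-- Change of coefficients on cocycles. -/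
def singularCocyclesMap (X : Type*) [TopologicalSpace X] {A B : Type*} [AddCommGroup A]
    [AddCommGroup B] (f : A →+ B) : singularCocycles X A →+ singularCocycles X B where
  toFun c := ⟨fun p => f (c.1 p), by
    intro s
    rw [← map_sub, ← map_add, c.2 s, map_zero]⟩
  map_zero' := by ext p; simp
  map_add' c d := by ext p; simp

/-- The change of coefficients homomorphism `H¹(X; A) → H¹(X; B)`. -/
def SingularH1.map (X : Type*) [TopologicalSpace X] {A B : Type*} [AddCommGroup A]
    [AddCommGroup B] (f : A →+ B) : SingularH1 X A →+ SingularH1 X B :=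
  QuotientAddGroup.map _ _ (singularCocyclesMap X f) (by
    rintro _ ⟨g, rfl⟩
    refine ⟨fun x => f (g x), ?_⟩
    ext p
    simp [singularCocyclesMap, singularCoboundary])

/-! ### Winding numbers -/

/-- `φ` is a continuous logarithm along the curve `f : I → ℂ`. -/
def IsLogLift (f : I → ℂ) (φ : C(I, ℂ)) : Prop :=
  ∀ t, Complex.exp (φ t) = f t

/-- The closed curve `f : I → ℂ ∖ {0}` is continuous and has winding number `n` around `0`. -/
def IsWindingNumber (f : I → ℂ) (n : ℤ) : Prop :=
  ∃ φ : C(I, ℂ), IsLogLift f φ ∧ φ 1 - φ 0 = 2 * Real.pi * Complex.I * n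

open Classical in
/-- The winding number around `0` of a closed curve (`0` if there is none). -/
def windingNumber (f : I → ℂ) : ℤ :=
  if h : ∃ n, IsWindingNumber f n then h.choose else 0

open Classical in
/-- The total variation `∫ d (arg f)` of the argument along a (not necessarily closed) curve `f`
in `ℂ ∖ {0}`, computed with any continuous logarithm (`0` if there is none). -/
def argVariation (f : I → ℂ) : ℝ :=
  if h : ∃ φ : C(I, ℂ), IsLogLift f φ then (h.choose 1 - h.choose 0).im else 0

variable (H : Type*) [NormedAddCommGroup H] [InnerProductSpace ℂ H] [CompleteSpace H]

/-! ### The self-adjoint Grassmannian -/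

/-- A fixed index set of an orthonormal (Hilbert) basis of `H`. -/
def hilbertIndex : Set H := (exists_hilbertBasis ℂ H).choose

/-- A fixed orthonormal (Hilbert) basis of `H`. -/
def hilbertBasisOf : HilbertBasis (hilbertIndex H) ℂ H :=
  (exists_hilbertBasis ℂ H).choose_spec.choose

variable {H}

/-- `K` is a Hilbert-Schmidt operator: `Tr (K† K) = ∑ᵢ ‖K eᵢ‖² < ∞` for an orthonormal basis
`(eᵢ)` (the sum does not depend on the basis). -/
def IsHilbertSchmidt (K : H →L[ℂ] H) : Prop :=
  Memℓp (fun i => K (hilbertBasisOf H i)) 2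

variable (H) in
/-- The self-adjoint Grassmannian: all unitary operators `U = I + K` of `H` with `K`
Hilbert-Schmidt. -/
def SelfAdjointGrassmannian : Type _ :=
  {U : unitary (H →L[ℂ] H) // IsHilbertSchmidt ((U : H →L[ℂ] H) - 1)}

namespace SelfAdjointGrassmannian

/-- The unitary operator that a point of the self-adjoint Grassmannian is. -/
def op (U : SelfAdjointGrassmannian H) : H →L[ℂ] H := U.1

/-- The Hilbert-Schmidt operator `K = U - I`, as the point `(K eᵢ)ᵢ` of the `ℓ²` sum of copies
of `H`; the norm of this point is the Hilbert-Schmidt norm of `K`. -/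
def toLp (U : SelfAdjointGrassmannian H) : lp (fun _ : hilbertIndex H => H) 2 :=
  ⟨fun i => (U.op - 1) (hilbertBasisOf H i), U.2⟩

/-- The topology of the self-adjoint Grassmannian is that of the Hilbert-Schmidt distance
`‖U - V‖₂ = (Tr ((U - V)† (U - V)))^(1/2)`. -/
instance : TopologicalSpace (SelfAdjointGrassmannian H) :=
  TopologicalSpace.induced toLp inferInstance

end SelfAdjointGrassmannian

/-! ### Regularized determinant and Maslov index -/

/-- The multiplicity of the eigenvalue `z` of `T` (`0` if `z` is not an eigenvalue). It is only
used for normal operators and for eigenvalues of finite multiplicity. -/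
def eigenMult (T : H →L[ℂ] H) (z : ℂ) : ℕ :=
  Module.finrank ℂ (Module.End.eigenspace (T : H →ₗ[ℂ] H) z)

/-- The factor `((1 + z) e^{-z})^d` that an eigenvalue `z` of `K = U - I` of multiplicity `d`
contributes to the regularized determinant (`1` if `z` is `0` or not an eigenvalue). -/
def regDetFactor (U : SelfAdjointGrassmannian H) (z : ℂ) : ℂ :=
  ((1 + z) * Complex.exp (-z)) ^ eigenMult (U.op - 1) z

/-- The regularized (Hilbert-Carleman) determinant `∏ₖ ((1 + λₖ) e^{-λₖ})^{dₖ}` of `U = I + K`,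
where `λₖ` are the eigenvalues of `K` and `dₖ` their multiplicities. -/
def regDet (U : SelfAdjointGrassmannian H) : ℂ :=
  ∏' z : ℂ, regDetFactor U z

/-- A closed curve `S¹ → X`, run through once anticlockwise from `1` as a path on `[0,1]`. -/
def loopPath {X : Type*} [TopologicalSpace X] (γ : C(Circle, X)) : C(I, X) where
  toFun t := γ (Circle.exp (2 * Real.pi * (t : ℝ)))
  continuous_toFun := by fun_prop

/-- The Maslov index of a closed curve: the winding number of the regularized determinant. -/
def maslovIndex (γ : C(Circle, SelfAdjointGrassmannian H)) : ℤ :=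
  windingNumber fun t => regDet (loopPath γ t)

variable (H) in
/-- The 1-cochain `p ↦ ∫_p α` of the Maslov form `α = (1/2π) d (arg det')`. -/
def maslovCochain (p : C(I, SelfAdjointGrassmannian H)) : ℝ :=
  argVariation (fun t => regDet (p t)) / (2 * Real.pi)

/-! ### The Cayley submanifold and the Cayley index -/

variable (H) in
/-- The Cayley submanifold of all `U` in the self-adjoint Grassmannian with `-1 ∈ σ(U)`. -/
def cayleySubmanifold : Set (SelfAdjointGrassmannian H) :=
  {U | (-1 : ℂ) ∈ spectrum ℂ U.op}

/-- The number of eigenvalues, with multiplicity, of `U` on the half-open arc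
`{e^{iθ} : π ≤ θ < π + ε}` that starts at `-1` and runs anticlockwise. It is used for
`0 < ε < π` only; such an arc carries finitely many eigenvalues, of finite multiplicity. -/
def arcCount (U : SelfAdjointGrassmannian H) (ε : ℝ) : ℕ :=
  ∑ᶠ θ ∈ Set.Ico Real.pi (Real.pi + ε), eigenMult U.op (Circle.exp θ)

/-- `n` is the number of eigenvalues of `p` that pass through `-1` anticlockwise minus the number
of those that pass clockwise, with multiplicities. For this, `[0,1]` is cut into finitely many
intervals `[tⱼ, tⱼ₊₁]` over each of which no eigenvalue meets the two ends `e^{i(π ± εⱼ)}` of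
some arc around `-1`; there the net number of passages through `-1` is the increase of the number
of eigenvalues on `{e^{iθ} : π ≤ θ < π + εⱼ}`. An eigenvalue `-1` at an end of the path counts as
having passed. -/
def IsCrossingNumber (p : C(I, SelfAdjointGrassmannian H)) (n : ℤ) : Prop :=
  ∃ (N : ℕ) (t : ℕ → I) (ε : ℕ → ℝ), Monotone t ∧ t 0 = 0 ∧ t N = 1 ∧
    (∀ j < N, 0 < ε j ∧ ε j < Real.pi ∧ ∀ s ∈ Set.Icc (t j) (t (j + 1)),
      (Circle.exp (Real.pi + ε j) : ℂ) ∉ spectrum ℂ (p s).op ∧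
      (Circle.exp (Real.pi - ε j) : ℂ) ∉ spectrum ℂ (p s).op) ∧
    n = ∑ j ∈ Finset.range N,
      ((arcCount (p (t (j + 1))) (ε j) : ℤ) - (arcCount (p (t j)) (ε j) : ℤ))

variable (H) in
open Classical in
/-- The Cayley index of a path: the signed number of its crossings through the Cayley
submanifold. As a function of the path it is an integral 1-cochain, the intersection number
with the Cayley submanifold. -/
def cayleyCochain (p : C(I, SelfAdjointGrassmannian H)) : ℤ :=
  if h : ∃ n, IsCrossingNumber p n then h.choose else 0

/-- The Cayley index of a closed curve. -/
def cayleyIndex (γ : C(Circle, SelfAdjointGrassmannian H)) : ℤ :=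
  cayleyCochain H (loopPath γ)

/-- `m` is the net number of eigenvalues, with multiplicity, that pass through `-1` anticlockwise
at the parameter value `θ₀`, an isolated crossing of the closed curve `γ`: the number of
eigenvalues just past `-1` shortly after `θ₀`, minus that number shortly before `θ₀`. -/
def IsLocalCrossingIndex (γ : C(Circle, SelfAdjointGrassmannian H)) (θ₀ : ℝ) (m : ℤ) : Prop :=
  ∀ᶠ ε in 𝓝[>] (0 : ℝ), ∀ᶠ s in 𝓝[<] θ₀, ∀ᶠ r in 𝓝[>] θ₀,
    (arcCount (γ (Circle.exp r)) ε : ℤ) - (arcCount (γ (Circle.exp s)) ε : ℤ) = m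

end

/-!
The topology of the self-adjoint Grassmannian is controlled by *cuts*: points `w ≠ 1` of the unit
circle outside the spectrum of `U = 1 + K`. Since `K` is compact, the spectrum of `U` is discrete
away from `1` (`finite_setOf_eig_ne_bot`), so that every `U` has cuts, even arbitrarily close to
`-1` on both sides, and a cut of `U` is a cut of all nearby operators. The open set of all `U` with
the cut `w` is contracted to the identity by a hyperbolic Möbius transformation of the circle with
fixed points `1` and `w` (`flow`); only resolvents are needed to write it down and to see that it is
continuous in the Hilbert–Schmidt norm, also in `w`.

Let `c` be a singular 1-cocycle with values in any abelian group. Because of the contraction, on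
the set of all `U` with the cut `w` it is the coboundary of a function `primitive c w`. This
function does not change while `w` moves outside the spectrum, and when `w` crosses one eigenvalue
anticlockwise it increases by the value `n` of `c` on a loop that turns one unit vector once: the
two ways to turn the eigenvector from `1` to its eigenvalue differ by such a loop
(`primitive_sub_twist`), and all such loops are freely homotopic (`cocycle_rotationLoop`). Hence
`primitive c w U - primitive c w' U` is `n` times the number of eigenvalues between the cuts, and
summation over a partition as in the definition of the crossing number `ν` of a path `p` gives
`c p = G (p 1) - G (p 0) + ν • n` for one function `G` (`exists_cocycle_eq`).

The rest of the theorem is this formula. For the variation of a continuous logarithm of the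
regularized determinant, `n` is `2πi`; so the crossing number of a path is unique, is itself a
cocycle, agrees with the winding number on closed curves, and differs from the Maslov cochain by a
coboundary. For an arbitrary integral cocycle the formula says that its class is `n` times the class
of the Cayley cochain, and `n` is unique because the Cayley index of the loop above is `1`.

The remaining analytic input is that the regularized determinant converges and is continuous. With
a branch of the logarithm on the plane cut at `w`, the function `log z - (z - 1)` vanishes to second
order at `1`, hence equals `h(z) |z - 1|²` on the circle with a continuous function `h`; in an
orthonormal basis of eigenvectors (`exists_eigenbasis`) the sum of its values over the spectrum of
`U` is the Hilbert–Schmidt product `⟨K, h(U) K⟩`, which depends continuously on `U`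
(`hasSum_regDetLog`, `continuousAt_regDetLog`), and its exponential is the determinant.

The local crossing indices are the jumps of the Cayley index of the curve over `[0, t]` as a function
of `t`; subtracting a step function with the same jumps shows that their sum is the increment over a
period (`exists_localCrossingIndex`).
-/

universe u

/-! ### Hilbert–Schmidt operators as square-summable families -/

section HilbertSchmidt

variable {H : Type*} [NormedAddCommGroup H] [InnerProductSpace ℂ H] [CompleteSpace H]

/-- The `ℓ²` sum of copies of `H` in which a Hilbert–Schmidt operator `T` is recorded as the family
`(T eᵢ)ᵢ`. -/
abbrev HSSpace (H : Type*) [NormedAddCommGroup H] [InnerProductSpace ℂ H] [CompleteSpace H] :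
    Type _ :=
  lp (fun _ : hilbertIndex H => H) 2

lemma HSSpace.ext_iff_apply {ξ η : HSSpace H} : ξ = η ↔ ∀ i, ξ i = η i :=
  ⟨fun h i => by rw [h], fun h => lp.ext (funext h)⟩

/-- Left multiplication by a bounded operator, applied to each member of a family. -/
noncomputable def leftMul : (H →L[ℂ] H) →L[ℂ] HSSpace H →L[ℂ] HSSpace H :=
  LinearMap.mkContinuous₂
    (LinearMap.mk₂ ℂ (fun A ξ => lp.mapCLM 2 (fun _ => A) (norm_nonneg A) (fun _ => le_rfl) ξ)
      (fun A B ξ => by ext i; simp) (fun c A ξ => by ext i; simp)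
      (fun A ξ η => by simp) (fun c A ξ => by simp)) 1
    (fun A ξ => by
      rw [one_mul]
      exact ContinuousLinearMap.le_of_opNorm_le _
        (lp.norm_mapCLM_le 2 (fun _ => A) (norm_nonneg A) (fun _ => le_rfl)) _)

@[simp]
lemma leftMul_apply (A : H →L[ℂ] H) (ξ : HSSpace H) (i : hilbertIndex H) :
    leftMul A ξ i = A (ξ i) := by
  simp [leftMul]

lemma hasSum_norm_sq (ξ : HSSpace H) : HasSum (fun i => ‖ξ i‖ ^ 2) (‖ξ‖ ^ 2) := by
  have h := lp.hasSum_norm (p := 2) (by norm_num) ξ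
  simpa using h

/-- The Hilbert–Schmidt norm dominates the operator norm. -/
lemma norm_apply_le_of_hilbertSchmidt (T : H →L[ℂ] H) (ξ : HSSpace H)
    (h : ∀ i, ξ i = T (hilbertBasisOf H i)) (x : H) : ‖T x‖ ≤ ‖ξ‖ * ‖x‖ := by
  have hx := (hilbertBasisOf H).hasSum_repr x
  have hTx := T.hasSum hx
  have h2 : ‖(hilbertBasisOf H).repr x‖ = ‖x‖ := by simp
  have hc : HasSum (fun i => ‖(hilbertBasisOf H).repr x i‖ ^ 2) (‖x‖ ^ 2) := by
    have := lp.hasSum_norm (p := 2) (by norm_num) ((hilbertBasisOf H).repr x)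
    simpa using this
  refine le_of_tendsto hTx.norm (Eventually.of_forall fun s => ?_)
  calc ‖∑ i ∈ s, T ((hilbertBasisOf H).repr x i • hilbertBasisOf H i)‖
      ≤ ∑ i ∈ s, ‖ξ i‖ * ‖(hilbertBasisOf H).repr x i‖ := by
        refine (norm_sum_le _ _).trans (Finset.sum_le_sum fun i _ => ?_)
        rw [map_smul, norm_smul, h, mul_comm]
    _ ≤ √(∑ i ∈ s, ‖ξ i‖ ^ 2) * √(∑ i ∈ s, ‖(hilbertBasisOf H).repr x i‖ ^ 2) :=
        Real.sum_mul_le_sqrt_mul_sqrt _ _ _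
    _ ≤ √(‖ξ‖ ^ 2) * √(‖x‖ ^ 2) := by
        gcongr
        · exact sum_le_hasSum _ (fun _ _ => by positivity) (hasSum_norm_sq ξ)
        · exact sum_le_hasSum _ (fun _ _ => by positivity) hc
    _ = ‖ξ‖ * ‖x‖ := by simp

/-- The family `(⟨v, eᵢ⟩ w)ᵢ` of the rank-one operator `x ↦ ⟨v, x⟩ w`. -/
lemma memℓp_rankOne (v w : H) :
    Memℓp (fun i => inner ℂ v (hilbertBasisOf H i) • w) 2 := by
  have h := ((lp.memℓp ((hilbertBasisOf H).repr v)).norm.const_mul ‖w‖)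
  refine Memℓp.of_norm (h.mono fun i => ?_)
  simp only [norm_norm, norm_mul, norm_smul]
  rw [mul_comm, HilbertBasis.repr_apply_apply, norm_inner_symm]

/-- The point of `HSSpace H` that represents `x ↦ ⟨v, x⟩ w`. -/
noncomputable def rankOneHS (v w : H) : HSSpace H := ⟨_, memℓp_rankOne v w⟩

lemma rankOneHS_apply (v w : H) (i : hilbertIndex H) :
    rankOneHS v w i = inner ℂ v (hilbertBasisOf H i) • w := rfl

lemma norm_rankOneHS (v w : H) : ‖rankOneHS v w‖ = ‖v‖ * ‖w‖ := by
  have hc : HasSum (fun i => ‖(hilbertBasisOf H).repr v i‖ ^ 2) (‖v‖ ^ 2) := by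
    have := lp.hasSum_norm (p := 2) (by norm_num) ((hilbertBasisOf H).repr v)
    simpa using this
  have h2 : HasSum (fun i => ‖rankOneHS v w i‖ ^ 2) (‖v‖ ^ 2 * ‖w‖ ^ 2) := by
    convert! hc.mul_right (‖w‖ ^ 2) using 2 with i
    rw [rankOneHS_apply, norm_smul, mul_pow, HilbertBasis.repr_apply_apply, norm_inner_symm]
  have := (hasSum_norm_sq (rankOneHS v w)).unique h2
  rw [← mul_pow] at this
  exact (pow_left_inj₀ (norm_nonneg _) (by positivity) two_ne_zero).1 this

lemma continuous_rankOneHS : Continuous fun v : H => rankOneHS v v := by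
  let B : H →L⋆[ℂ] H →L[ℂ] HSSpace H := LinearMap.mkContinuous₂
    (LinearMap.mk₂'ₛₗ (starRingEnd ℂ) (RingHom.id ℂ) (fun v w => rankOneHS v w)
      (fun v v' w => by
        rw [HSSpace.ext_iff_apply]; intro i; simp [rankOneHS_apply, add_smul])
      (fun c v w => by
        rw [HSSpace.ext_iff_apply]; intro i; simp [rankOneHS_apply, mul_smul]; rw [smul_comm])
      (fun v w w' => by rw [HSSpace.ext_iff_apply]; intro i; simp [rankOneHS_apply])
      (fun c v w => by
        rw [HSSpace.ext_iff_apply]; intro i; simp [rankOneHS_apply, smul_comm c])) 1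
    (fun v w => by
      rw [one_mul]
      exact (norm_rankOneHS v w).le)
  have : Continuous fun v : H => B v v := by fun_prop
  exact this

lemma IsHilbertSchmidt.comp_left {T : H →L[ℂ] H} (hT : IsHilbertSchmidt T) (A : H →L[ℂ] H) :
    IsHilbertSchmidt (A * T) := by
  have := lp.memℓp (leftMul A (⟨_, hT⟩ : HSSpace H))
  exact (by simpa [IsHilbertSchmidt] using! this)

lemma IsHilbertSchmidt.add {S T : H →L[ℂ] H} (hS : IsHilbertSchmidt S) (hT : IsHilbertSchmidt T) :
    IsHilbertSchmidt (S + T) := Memℓp.add hS hT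

lemma IsHilbertSchmidt.smul {T : H →L[ℂ] H} (hT : IsHilbertSchmidt T) (c : ℂ) :
    IsHilbertSchmidt (c • T) := Memℓp.const_smul hT c

open InnerProductSpace in
lemma isHilbertSchmidt_rankOne (v w : H) : IsHilbertSchmidt (rankOne ℂ w v) := by
  simpa [IsHilbertSchmidt] using! memℓp_rankOne v w

open InnerProductSpace in
/-- A Hilbert–Schmidt operator is the norm limit of its finite-rank truncations. -/
lemma IsHilbertSchmidt.isCompactOperator {T : H →L[ℂ] H} (hT : IsHilbertSchmidt T) :
    IsCompactOperator T := by
  classical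
  let ξ : HSSpace H := ⟨_, hT⟩
  let F : Finset (hilbertIndex H) → (H →L[ℂ] H) := fun s =>
    ∑ i ∈ s, rankOne ℂ (T (hilbertBasisOf H i)) (hilbertBasisOf H i)
  have hF : ∀ s, IsCompactOperator (F s) := by
    intro s
    refine Submodule.sum_mem (compactOperator (RingHom.id ℂ) H H) fun i _ => ?_
    exact (isCompactOperator_of_locallyCompactSpace_dom
      (InnerProductSpace.toDual ℂ H (hilbertBasisOf H i) : H →L[ℂ] ℂ)).clm_comp
      (ContinuousLinearMap.toSpanSingleton ℂ (T (hilbertBasisOf H i)))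
  refine isCompactOperator_of_tendsto (F := F) (l := atTop) ?_ (Eventually.of_forall hF)
  have hsum := lp.hasSum_single (p := 2) (by norm_num) ξ
  rw [tendsto_iff_norm_sub_tendsto_zero]
  have h0 := (tendsto_iff_norm_sub_tendsto_zero).1 hsum
  refine squeeze_zero (fun _ => norm_nonneg _) (fun s => ?_) h0
  refine ContinuousLinearMap.opNorm_le_bound _ (norm_nonneg _) fun x => ?_
  refine norm_apply_le_of_hilbertSchmidt _ _ (fun j => ?_) x
  have hb := (hilbertBasisOf H).orthonormal
  rw [orthonormal_iff_ite] at hb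
  simp only [lp.coeFn_sub, lp.coeFn_sum, Pi.sub_apply, Finset.sum_apply, lp.single_apply]
  simp [F, ξ, hb, Pi.single_apply]

end HilbertSchmidt

namespace SelfAdjointGrassmannian

variable {H : Type*} [NormedAddCommGroup H] [InnerProductSpace ℂ H] [CompleteSpace H]

open Module.End ContinuousLinearMap

/-! ### Points of the self-adjoint Grassmannian and their spectra -/

@[simp]
lemma toLp_apply (U : SelfAdjointGrassmannian H) (i : hilbertIndex H) :
    U.toLp i = (U.op - 1) (hilbertBasisOf H i) := rfl

lemma op_mem_unitary (U : SelfAdjointGrassmannian H) : U.op ∈ unitary (H →L[ℂ] H) := U.1.2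

lemma isHilbertSchmidt (U : SelfAdjointGrassmannian H) : IsHilbertSchmidt (U.op - 1) := U.2

lemma op_injective : Function.Injective (op (H := H)) := fun _ _ h =>
  Subtype.ext (Subtype.ext h)

lemma continuous_toLp : Continuous (toLp (H := H)) := continuous_induced_dom

lemma continuous_iff_toLp {Y : Type*} [TopologicalSpace Y] {f : Y → SelfAdjointGrassmannian H} :
    Continuous f ↔ Continuous fun y => (f y).toLp := continuous_induced_rng

/-- The Hilbert–Schmidt topology is finer than the norm topology. -/
lemma continuous_op : Continuous (op (H := H)) := by
  refine continuous_iff_continuousAt.2 fun U => ?_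
  rw [ContinuousAt, tendsto_iff_norm_sub_tendsto_zero]
  have h0 := (tendsto_iff_norm_sub_tendsto_zero).1 (continuous_toLp.tendsto U)
  refine squeeze_zero (fun _ => norm_nonneg _) (fun V => ?_) h0
  refine ContinuousLinearMap.opNorm_le_bound _ (norm_nonneg _) fun x => ?_
  exact norm_apply_le_of_hilbertSchmidt _ _ (fun j => by simp) x

/-- The identity operator as a point of the self-adjoint Grassmannian. -/
noncomputable instance : One (SelfAdjointGrassmannian H) :=
  ⟨⟨1, by simpa [IsHilbertSchmidt] using! zero_memℓp⟩⟩

@[simp] lemma op_one : (1 : SelfAdjointGrassmannian H).op = 1 := rfl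

lemma adjoint_mul_op (U : SelfAdjointGrassmannian H) : adjoint U.op * U.op = 1 :=
  (Unitary.mem_iff.1 U.op_mem_unitary).1

lemma op_mul_adjoint (U : SelfAdjointGrassmannian H) : U.op * adjoint U.op = 1 :=
  (Unitary.mem_iff.1 U.op_mem_unitary).2

lemma adjoint_op_apply (U : SelfAdjointGrassmannian H) (x : H) :
    adjoint U.op (U.op x) = x := congrArg (· x) U.adjoint_mul_op

lemma inner_op_op (U : SelfAdjointGrassmannian H) (x y : H) :
    inner ℂ (U.op x) (U.op y) = inner ℂ x y := by
  rw [← adjoint_inner_right, adjoint_op_apply]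

lemma norm_op_apply (U : SelfAdjointGrassmannian H) (x : H) : ‖U.op x‖ = ‖x‖ := by
  rw [@norm_eq_sqrt_re_inner ℂ, inner_op_op, ← @norm_eq_sqrt_re_inner ℂ]

lemma isStarNormal_op (U : SelfAdjointGrassmannian H) : IsStarNormal U.op :=
  ⟨by rw [commute_iff_eq]; exact U.adjoint_mul_op.trans U.op_mul_adjoint.symm⟩

lemma norm_eq_one_of_mem_spectrum (U : SelfAdjointGrassmannian H) {z : ℂ}
    (hz : z ∈ spectrum ℂ U.op) : ‖z‖ = 1 := by
  simpa using spectrum.subset_circle_of_unitary U.op_mem_unitary hz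

/-- The eigenspace of the unitary operator `U` at `z`. -/
abbrev eig (U : SelfAdjointGrassmannian H) (z : ℂ) : Submodule ℂ H :=
  eigenspace (U.op : H →ₗ[ℂ] H) z

lemma mem_eig (U : SelfAdjointGrassmannian H) {z : ℂ} {x : H} : x ∈ U.eig z ↔ U.op x = z • x :=
  mem_eigenspace_iff

lemma eigenspace_op_sub_one (U : SelfAdjointGrassmannian H) (z : ℂ) :
    eigenspace ((U.op - 1 : H →L[ℂ] H) : H →ₗ[ℂ] H) z = U.eig (1 + z) := by
  ext x
  rw [mem_eigenspace_iff, mem_eig]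
  simp [sub_eq_iff_eq_add, add_smul, add_comm]

lemma eigenMult_op_sub_one (U : SelfAdjointGrassmannian H) (z : ℂ) :
    eigenMult (U.op - 1) z = eigenMult U.op (1 + z) := by
  rw [eigenMult, eigenspace_op_sub_one, eigenMult]

lemma norm_eq_one_of_mem_eig (U : SelfAdjointGrassmannian H) {z : ℂ} {x : H} (hx : x ∈ U.eig z)
    (h0 : x ≠ 0) : ‖z‖ = 1 := by
  have h := U.norm_op_apply x
  rw [U.mem_eig.1 hx, norm_smul] at h
  exact (mul_eq_right₀ (norm_ne_zero_iff.2 h0)).1 h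

lemma isCompactOperator_op_sub_one (U : SelfAdjointGrassmannian H) :
    IsCompactOperator (U.op - 1 : H →L[ℂ] H) := U.isHilbertSchmidt.isCompactOperator

/-- Away from `1`, the spectrum of `U` consists of eigenvalues: the Fredholm alternative. -/
lemma mem_spectrum_iff (U : SelfAdjointGrassmannian H) {z : ℂ} (hz : z ≠ 1) :
    z ∈ spectrum ℂ U.op ↔ U.eig z ≠ ⊥ := by
  have h1 := U.isCompactOperator_op_sub_one.hasEigenvalue_iff_mem_spectrum (sub_ne_zero.2 hz)
  rw [hasEigenvalue_iff, eigenspace_op_sub_one, add_sub_cancel] at h1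
  rw [h1]
  have h2 : z ∈ spectrum ℂ U.op ↔ z - 1 ∈ spectrum ℂ (U.op - algebraMap ℂ (H →L[ℂ] H) 1) := by
    rw [← spectrum.sub_singleton_eq]
    simp
  rw [h2, map_one]

/-- Being outside the spectrum is an open condition on the operator and the number jointly. -/
lemma isOpen_notMem_spectrum :
    IsOpen {p : ℂ × SelfAdjointGrassmannian H | p.1 ∉ spectrum ℂ p.2.op} := by
  have : {p : ℂ × SelfAdjointGrassmannian H | p.1 ∉ spectrum ℂ p.2.op} =
      (fun p : ℂ × SelfAdjointGrassmannian H =>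
        algebraMap ℂ (H →L[ℂ] H) p.1 - p.2.op) ⁻¹' {a | IsUnit a} := by
    ext p
    simp [spectrum.mem_iff]
  rw [this]
  refine Units.isOpen.preimage ?_
  exact ((continuous_algebraMap ℂ (H →L[ℂ] H)).comp continuous_fst).sub
    (continuous_op.comp continuous_snd)

lemma finiteDimensional_eig (U : SelfAdjointGrassmannian H) {z : ℂ} (hz : z ≠ 1) :
    FiniteDimensional ℂ (U.eig z) := by
  have := ContinuousLinearMap.finite_dimensional_eigenspace U.isCompactOperator_op_sub_one
    (z - 1) (sub_ne_zero.2 hz)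
  erw [eigenspace_op_sub_one, add_sub_cancel] at this
  exact this

lemma adjoint_op_of_mem_eig (U : SelfAdjointGrassmannian H) {z : ℂ} {x : H} (hx : x ∈ U.eig z) :
    adjoint U.op x = (starRingEnd ℂ) z • x := by
  rcases eq_or_ne x 0 with rfl | h0
  · simp
  have hn := U.norm_eq_one_of_mem_eig hx h0
  have h := U.adjoint_op_apply x
  rw [U.mem_eig.1 hx, map_smul] at h
  have h2 := congrArg ((starRingEnd ℂ) z • ·) h
  simpa [smul_smul, Complex.conj_mul', hn] using h2

lemma orthogonalFamily_eig (U : SelfAdjointGrassmannian H) :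
    OrthogonalFamily ℂ (fun z => U.eig z) fun z => (U.eig z).subtypeₗᵢ := by
  intro z w hzw x y
  have h := adjoint_inner_right U.op (x : H) y
  rw [U.mem_eig.1 x.2, U.adjoint_op_of_mem_eig y.2, inner_smul_left, inner_smul_right,
    ← sub_eq_zero, ← sub_mul, ← map_sub] at h
  refine (mul_eq_zero.1 h).resolve_left ?_
  exact (map_ne_zero _).2 (sub_ne_zero.2 hzw.symm)

/-- The operator `K†K` preserves the orthogonal complement of all eigenspaces of `U`; an
eigenspace of this compact self-adjoint operator in the complement would contain an eigenvector of
`U`, so the complement is trivial. -/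
lemma orthogonal_iSup_eig (U : SelfAdjointGrassmannian H) : (⨆ z, U.eig z)ᗮ = ⊥ := by
  set W : Submodule ℂ H := (⨆ z, U.eig z)ᗮ with hW
  have memW : ∀ {x : H}, x ∈ W ↔ ∀ z, ∀ y ∈ U.eig z, inner ℂ y x = 0 := by
    intro x
    rw [hW, ← Submodule.iInf_orthogonal]
    simp [Submodule.mem_orthogonal]
  have hUW : ∀ x ∈ W, U.op x ∈ W := by
    intro x hx
    refine memW.2 fun z y hy => ?_
    rw [← adjoint_inner_left, U.adjoint_op_of_mem_eig hy, inner_smul_left, memW.1 hx z y hy,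
      mul_zero]
  have hUW' : ∀ x ∈ W, adjoint U.op x ∈ W := by
    intro x hx
    refine memW.2 fun z y hy => ?_
    rw [adjoint_inner_right, U.mem_eig.1 hy, inner_smul_left, memW.1 hx z y hy, mul_zero]
  have hEW : ∀ {z : ℂ} {x : H}, x ∈ W → U.op x = z • x → x = 0 := by
    intro z x hx h
    exact inner_self_eq_zero.1 (memW.1 hx z x (U.mem_eig.2 h))
  set K : H →L[ℂ] H := U.op - 1 with hK
  set T : H →L[ℂ] H := adjoint K ∘L K with hT
  have hTx : ∀ x, T x = (x - U.op x) + (x - adjoint U.op x) := by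
    intro x
    have : adjoint (1 : H →L[ℂ] H) = 1 := star_one _
    simp only [hT, hK, map_sub, this, coe_comp, Function.comp_apply, sub_apply, one_apply_eq_self,
      adjoint_op_apply]
    abel
  have hTc : IsCompactOperator T := U.isCompactOperator_op_sub_one.clm_comp (adjoint K)
  have hTs : (T : H →ₗ[ℂ] H).IsSymmetric := by
    intro x y
    change inner ℂ (adjoint K (K x)) y = inner ℂ x (adjoint K (K y))
    rw [adjoint_inner_left, adjoint_inner_right]
  have hTW : ∀ x ∈ W, T x ∈ W := by
    intro x hx
    rw [hTx]
    exact W.add_mem (W.sub_mem hx (hUW x hx)) (W.sub_mem hx (hUW' x hx))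
  have hKT : ∀ x, K (T x) = T (K x) := by
    intro x
    have h1 : U.op (adjoint U.op x) = x := congrArg (· x) U.op_mul_adjoint
    simp only [hTx, hK, sub_apply, one_apply_eq_self, map_add, map_sub, adjoint_op_apply, h1]
  -- an eigenvector of `K†K` in the complement exists by the spectral theorem
  by_contra hne
  have hS := orthogonalComplement_iSup_eigenspaces_eq_bot (T := T.restrict hTW)
    (hTc.restrict' hTW) (hTs.restrict_invariant hTW)
  obtain ⟨μ, hμ⟩ : ∃ μ, eigenspace (T.restrict hTW : Module.End ℂ W) μ ≠ ⊥ := by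
    by_contra! hall
    simp only [hall, iSup_bot, Submodule.bot_orthogonal_eq_top] at hS
    exact hne (Submodule.subsingleton_iff_eq_bot.1
      ((Submodule.subsingleton_iff ℂ).1 (subsingleton_of_bot_eq_top hS.symm)))
  obtain ⟨⟨w, hw⟩, hwμ, hw0⟩ := Submodule.exists_mem_ne_zero_of_ne_bot hμ
  have hTw : T w = μ • w := congrArg Subtype.val (mem_eigenspace_iff.1 hwμ)
  have hw0' : w ≠ 0 := fun h => hw0 (Subtype.ext h)
  rcases eq_or_ne μ 0 with rfl | hμ0
  · have h1 : inner ℂ (K w) (K w) = 0 := by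
      rw [← adjoint_inner_right]
      change inner ℂ w (T w) = 0
      rw [hTw, zero_smul, inner_zero_right]
    have h2 : U.op w - w = 0 := inner_self_eq_zero.1 h1
    exact hw0' (hEW (z := 1) hw (by rw [one_smul]; exact sub_eq_zero.1 h2))
  · let V : Submodule ℂ H := eigenspace (T : H →ₗ[ℂ] H) μ ⊓ W
    have := ContinuousLinearMap.finite_dimensional_eigenspace hTc μ hμ0
    have hVf : FiniteDimensional ℂ V := Submodule.finiteDimensional_of_le inf_le_left
    have hVn : Nontrivial V := ⟨⟨w, mem_eigenspace_iff.2 hTw, hw⟩, 0, fun h =>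
      hw0' (congrArg Subtype.val h)⟩
    have hKV : ∀ x ∈ V, (K : H →ₗ[ℂ] H) x ∈ V := by
      rintro x ⟨hx, hxW⟩
      refine ⟨mem_eigenspace_iff.2 ?_, W.sub_mem (hUW x hxW) hxW⟩
      change T (K x) = μ • K x
      rw [← hKT, show T x = μ • x from mem_eigenspace_iff.1 hx, map_smul]
    obtain ⟨ν, hν⟩ := exists_eigenvalue ((K : H →ₗ[ℂ] H).restrict hKV)
    obtain ⟨x, hx, hx0⟩ := hν.exists_hasEigenvector
    have h1 : U.op (x : H) - x = ν • (x : H) := congrArg Subtype.val (mem_eigenspace_iff.1 hx)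
    refine hx0 (Subtype.ext (hEW (z := ν + 1) x.2.2 ?_))
    rw [add_smul, one_smul, ← h1, sub_add_cancel]

/-- A Hilbert basis of `H` that consists of eigenvectors of `U`; the number of its members in an
eigenspace is the multiplicity. -/
lemma exists_eigenbasis {H : Type u} [NormedAddCommGroup H] [InnerProductSpace ℂ H]
    [CompleteSpace H] (U : SelfAdjointGrassmannian H) :
    ∃ (ι : ℂ → Type u) (f : HilbertBasis (Σ z, ι z) ℂ H),
      (∀ k, f k ∈ U.eig k.1) ∧
      ∀ z, z ≠ 1 → Finite (ι z) ∧ eigenMult U.op z = Nat.card (ι z) := by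
  have hc : ∀ z, CompleteSpace (U.eig z) := fun z => by
    have : IsClosed (U.eig z : Set H) := by
      have h : (U.eig z : Set H) = {x | U.op x = z • x} := by ext x; exact U.mem_eig
      rw [h]
      exact isClosed_eq U.op.continuous (continuous_const_smul z)
    exact this.completeSpace_coe
  choose s b hb using fun z => exists_hilbertBasis ℂ (U.eig z)
  have ho : Orthonormal ℂ fun k : Σ z, s z => ((b k.1 k.2 : U.eig k.1) : H) :=
    U.orthogonalFamily_eig.orthonormal_sigma_orthonormal fun z => (b z).orthonormal
  refine ⟨fun z => s z, HilbertBasis.mkOfOrthogonalEqBot ho ?_, fun k => ?_, fun z hz => ?_⟩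
  · rw [eq_bot_iff, ← U.orthogonal_iSup_eig, ← Submodule.iInf_orthogonal]
    intro x hx
    rw [Submodule.mem_iInf]
    intro z
    rw [Submodule.mem_orthogonal]
    intro y hy
    have hx' : ∀ j : s z, inner ℂ ((b z j : U.eig z) : H) x = 0 := fun j =>
      (Submodule.mem_orthogonal _ _).1 hx _ (Submodule.subset_span ⟨⟨z, j⟩, rfl⟩)
    have h1 := (b z).hasSum_repr ⟨y, hy⟩
    have h2 := (innerSL ℂ x).hasSum ((U.eig z).subtypeL.hasSum h1)
    have h3 : inner ℂ x y = 0 := by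
      refine h2.unique ?_
      convert! hasSum_zero using 2 with j
      simp [inner_eq_zero_symm.1 (hx' j)]
    exact inner_eq_zero_symm.1 h3
  · rw [HilbertBasis.coe_mkOfOrthogonalEqBot]
    exact (b k.1 k.2).2
  · have := U.finiteDimensional_eig hz
    have hfin : Finite (s z) := (b z).orthonormal.linearIndependent.finite
    refine ⟨hfin, ?_⟩
    have := Fintype.ofFinite (s z)
    rw [eigenMult, Module.finrank_eq_card_basis (b z).toOrthonormalBasis.toBasis,
      Nat.card_eq_fintype_card]

end SelfAdjointGrassmannian

/-! ### The trace in an eigenbasis -/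

section Trace

variable {H : Type*} [NormedAddCommGroup H] [InnerProductSpace ℂ H] [CompleteSpace H]

open ContinuousLinearMap

/-- Parseval's identity for square-summable families, as an absolutely convergent double sum. -/
lemma hasSum_inner_mul_inner_prod {κ : Type*} (f : HilbertBasis κ ℂ H) (ξ η : HSSpace H) :
    HasSum (fun p : hilbertIndex H × κ => inner ℂ (ξ p.1) (f p.2) * inner ℂ (f p.2) (η p.1))
      (inner ℂ ξ η) := by
  have hsq : ∀ ζ : HSSpace H,
      Summable fun p : hilbertIndex H × κ => ‖inner ℂ (f p.2) (ζ p.1)‖ ^ 2 := by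
    intro ζ
    have hj : ∀ i, HasSum (fun j => ‖inner ℂ (f j) (ζ i)‖ ^ 2) (‖ζ i‖ ^ 2) := by
      intro i
      have := lp.hasSum_norm (p := 2) (by norm_num) (f.repr (ζ i))
      simpa [f.repr_apply_apply] using this
    refine (summable_prod_of_nonneg fun p => by positivity).2 ⟨fun i => (hj i).summable, ?_⟩
    simp only [(hj _).tsum_eq]
    exact (hasSum_norm_sq ζ).summable
  have hs : Summable fun p : hilbertIndex H × κ =>
      inner ℂ (ξ p.1) (f p.2) * inner ℂ (f p.2) (η p.1) := by
    refine Summable.of_norm_bounded ((hsq ξ).add (hsq η)) fun p => ?_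
    rw [norm_mul, norm_inner_symm]
    nlinarith [sq_nonneg (‖inner ℂ (f p.2) (ξ p.1)‖ - ‖inner ℂ (f p.2) (η p.1)‖),
      sq_nonneg ‖inner ℂ (f p.2) (ξ p.1)‖, sq_nonneg ‖inner ℂ (f p.2) (η p.1)‖]
  have h1 := hs.hasSum.prod_fiberwise fun i => f.hasSum_inner_mul_inner (ξ i) (η i)
  have h2 := lp.hasSum_inner (𝕜 := ℂ) ξ η
  rw [← h1.unique h2]
  exact hs.hasSum

/-- The Hilbert–Schmidt product `⟨T, A T⟩` is the trace of `A T T†` in any Hilbert basis. -/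
lemma hasSum_trace {κ : Type*} (f : HilbertBasis κ ℂ H) (T A : H →L[ℂ] H) (ξ : HSSpace H)
    (hξ : ∀ i, ξ i = T (hilbertBasisOf H i)) :
    HasSum (fun j => inner ℂ (f j) (A (T (adjoint T (f j))))) (inner ℂ ξ (leftMul A ξ)) := by
  have h := hasSum_inner_mul_inner_prod f ξ (leftMul A ξ)
  have h' := (Equiv.prodComm κ (hilbertIndex H)).hasSum_iff.2 h
  refine h'.prod_fiberwise fun j => ?_
  have h1 := (hilbertBasisOf H).hasSum_inner_mul_inner (adjoint T (adjoint A (f j)))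
    (adjoint T (f j))
  rw [adjoint_inner_left, adjoint_inner_left] at h1
  convert! h1 using 2 with i
  simp only [Function.comp_apply, Equiv.prodComm_apply, Prod.fst_swap, Prod.snd_swap,
    leftMul_apply, hξ]
  rw [adjoint_inner_left, adjoint_inner_left, adjoint_inner_right, mul_comm]

end Trace

namespace SelfAdjointGrassmannian

variable {H : Type u} [NormedAddCommGroup H] [InnerProductSpace ℂ H] [CompleteSpace H]

/-- For an operator `A` that acts on each eigenspace of `U = 1 + K` at `z` as a scalar `h z`, the
trace of `A K K†` is `∑ h(z) |z - 1|²` over an eigenbasis. -/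
lemma hasSum_eigenbasis (U : SelfAdjointGrassmannian H) {ι : ℂ → Type u}
    {f : HilbertBasis (Σ z, ι z) ℂ H} (hf : ∀ k, f k ∈ U.eig k.1) {A : H →L[ℂ] H} {h : ℂ → ℂ}
    (hA : ∀ k, A (f k) = h k.1 • f k) :
    HasSum (fun k : Σ z, ι z => h k.1 * (‖k.1 - 1‖ ^ 2 : ℝ))
      (inner ℂ U.toLp (leftMul A U.toLp)) := by
  have h := hasSum_trace f (U.op - 1) A U.toLp (fun i => U.toLp_apply i)
  convert! h using 2 with k
  have h1 : ContinuousLinearMap.adjoint (U.op - 1) (f k) = (starRingEnd ℂ) (k.1 - 1) • f k := by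
    have : ContinuousLinearMap.adjoint (1 : H →L[ℂ] H) = 1 := star_one _
    rw [map_sub, this, sub_apply, U.adjoint_op_of_mem_eig (hf k), map_sub,
      sub_smul, map_one, one_smul, one_apply_eq_self]
  have h2 : (U.op - 1) (f k) = (k.1 - 1) • f k := by
    rw [sub_apply, U.mem_eig.1 (hf k), sub_smul, one_smul,
      one_apply_eq_self]
  have h3 : inner ℂ (f k) (f k) = (1 : ℂ) := by
    rw [inner_self_eq_norm_sq_to_K, f.orthonormal.1 k]; simp
  rw [h1, map_smul, h2, map_smul, map_smul, hA, inner_smul_right, inner_smul_right,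
    inner_smul_right, h3, ← mul_assoc, Complex.conj_mul']
  push_cast
  ring

/-- Only finitely many eigenvalues stay away from `1`. -/
lemma finite_setOf_eig_ne_bot (U : SelfAdjointGrassmannian H) {δ : ℝ} (hδ : 0 < δ) :
    {z : ℂ | δ ≤ ‖z - 1‖ ∧ U.eig z ≠ ⊥}.Finite := by
  obtain ⟨ι, f, hf, hcard⟩ := U.exists_eigenbasis
  have hs : Summable fun k : Σ z, ι z => ‖k.1 - 1‖ ^ 2 := by
    have := (U.hasSum_eigenbasis hf (A := 1) (h := fun _ => 1) (by simp)).summable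
    simp only [one_mul] at this
    exact Complex.summable_ofReal.1 this
  have hfin : {k : Σ z, ι z | ¬ ‖k.1 - 1‖ ^ 2 < δ ^ 2}.Finite :=
    hs.tendsto_cofinite_zero.eventually (gt_mem_nhds (by positivity : (0 : ℝ) < δ ^ 2))
  refine (hfin.image Sigma.fst).subset ?_
  rintro z ⟨hz, hE⟩
  have hz1 : z ≠ 1 := by
    rintro rfl
    simp at hz
    linarith
  have hfd := U.finiteDimensional_eig hz1
  have hpos : 0 < Nat.card (ι z) := by
    rw [← (hcard z hz1).2]
    have : Nontrivial (U.eig z) := Submodule.nontrivial_iff_ne_bot.2 hE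
    exact Module.finrank_pos
  obtain ⟨j⟩ := (Nat.card_pos_iff.1 hpos).1
  refine ⟨⟨z, j⟩, ?_, rfl⟩
  simp only [Set.mem_ofPred_eq, not_lt]
  gcongr

end SelfAdjointGrassmannian

namespace SelfAdjointGrassmannian

variable {H : Type*} [NormedAddCommGroup H] [InnerProductSpace ℂ H] [CompleteSpace H]

/-! ### The contraction of the unitary operators whose spectrum misses a point -/

/-- `c` is a point of the unit circle, other than `1`, at which the circle can be cut without
meeting the spectrum of `U`. -/
structure IsCut (c : ℂ) (U : SelfAdjointGrassmannian H) : Prop where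
  norm_eq_one : ‖c‖ = 1
  ne_one : c ≠ 1
  notMem : c ∉ spectrum ℂ U.op

/-- The denominator of the Möbius transformation `z ↦ 1 + s (1 - c) (z - 1) / ((z - c) - s (z - 1))`
that fixes `1` and `c`, evaluated at `U`. -/
noncomputable def flowDen (c s : ℂ) (U : SelfAdjointGrassmannian H) : H →L[ℂ] H :=
  (U.op - algebraMap ℂ _ c) - s • (U.op - 1)

/-- The numerator of the Möbius transformation of `flowDen`, evaluated at `U`. -/
noncomputable def flowNum (c s : ℂ) (U : SelfAdjointGrassmannian H) : H →L[ℂ] H :=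
  (1 - c * s) • U.op - algebraMap ℂ _ (c * (1 - s))

lemma IsCut.isUnit_flowDen {c : ℂ} {U : SelfAdjointGrassmannian H} (h : IsCut c U) (s : I) :
    IsUnit (flowDen c (s : ℝ) U) := by
  rcases eq_or_lt_of_le s.2.2 with hs | hs
  · have : flowDen c (s : ℝ) U = algebraMap ℂ _ (1 - c) := by
      rw [flowDen, hs, map_sub, map_one]
      simp
    rw [this]
    exact (IsUnit.mk0 _ (sub_ne_zero.2 h.ne_one.symm)).map _
  -- for `s < 1` the denominator is a multiple of `U - w`, where `w` is `c` or off the unit circle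
  have hs' : (1 - (s : ℝ) : ℂ) ≠ 0 := by
    rw [← Complex.ofReal_one, ← Complex.ofReal_sub, Complex.ofReal_ne_zero]
    linarith
  set w : ℂ := (c - (s : ℝ)) / (1 - (s : ℝ)) with hw
  have hD : flowDen c (s : ℝ) U = (-(1 - (s : ℝ) : ℂ)) • (algebraMap ℂ _ w - U.op) := by
    have : algebraMap ℂ (H →L[ℂ] H) c
        = (1 - (s : ℝ) : ℂ) • algebraMap ℂ (H →L[ℂ] H) w + ((s : ℝ) : ℂ) • 1 := by
      rw [Algebra.algebraMap_eq_smul_one, Algebra.algebraMap_eq_smul_one, smul_smul, ← add_smul,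
        hw, mul_div_cancel₀ _ hs']
      simp
    rw [flowDen, this]
    module
  have hwσ : w ∉ spectrum ℂ U.op := by
    intro hmem
    rcases eq_or_lt_of_le s.2.1 with hs0 | hs0
    · rw [hw, ← hs0] at hmem
      exact h.notMem (by simpa using hmem)
    have hn := U.norm_eq_one_of_mem_spectrum hmem
    rw [hw, norm_div, div_eq_one_iff_eq (norm_ne_zero_iff.2 hs')] at hn
    have h2 : ‖c - (s : ℝ)‖ ^ 2 = ‖(1 - (s : ℝ) : ℂ)‖ ^ 2 := by rw [hn]
    have h3 : c.re * c.re + c.im * c.im = 1 := by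
      have := Complex.normSq_eq_norm_sq c
      rw [h.norm_eq_one, Complex.normSq_apply] at this
      linarith
    rw [← Complex.normSq_eq_norm_sq, ← Complex.normSq_eq_norm_sq, Complex.normSq_apply,
      Complex.normSq_apply] at h2
    simp at h2
    have h4 : (s : ℝ) * (1 - c.re) = 0 := by nlinarith
    have h5 : c.re = 1 := by
      rcases mul_eq_zero.1 h4 with h | h <;> linarith
    have h6 : c.im = 0 := by rw [h5] at h3; nlinarith
    exact h.ne_one (Complex.ext (by simpa using h5) (by simpa using h6))
  rw [hD, Algebra.smul_def]
  exact ((IsUnit.mk0 _ (neg_ne_zero.2 hs')).map _).mul (spectrum.notMem_iff.1 hwσ)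

lemma commute_flowDen_op (c s : ℂ) (U : SelfAdjointGrassmannian H) :
    Commute (flowDen c s U) U.op := by
  refine Commute.sub_left ((Commute.refl _).sub_left (Algebra.commute_algebraMap_left _ _)) ?_
  exact ((Commute.refl _).sub_left (Commute.one_left _)).smul_left _

lemma star_mul_self_linear (U : SelfAdjointGrassmannian H) (a b : ℂ) :
    star (a • U.op - algebraMap ℂ _ b) * (a • U.op - algebraMap ℂ _ b) =
      (‖a‖ ^ 2 + ‖b‖ ^ 2 : ℂ) • (1 : H →L[ℂ] H) - (starRingEnd ℂ b * a) • U.op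
        - (starRingEnd ℂ a * b) • star U.op := by
  have h := U.adjoint_mul_op
  rw [← ContinuousLinearMap.star_eq_adjoint] at h
  simp only [star_sub, star_smul, Algebra.algebraMap_eq_smul_one, star_one, sub_mul, mul_sub,
    smul_mul_smul_comm, h, mul_one, one_mul, RCLike.star_def, Complex.conj_mul']
  module

lemma self_mul_star_linear (U : SelfAdjointGrassmannian H) (a b : ℂ) :
    (a • U.op - algebraMap ℂ _ b) * star (a • U.op - algebraMap ℂ _ b) =
      (‖a‖ ^ 2 + ‖b‖ ^ 2 : ℂ) • (1 : H →L[ℂ] H) - (starRingEnd ℂ b * a) • U.op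
        - (starRingEnd ℂ a * b) • star U.op := by
  have h := U.op_mul_adjoint
  rw [← ContinuousLinearMap.star_eq_adjoint] at h
  simp only [star_sub, star_smul, Algebra.algebraMap_eq_smul_one, star_one, sub_mul, mul_sub,
    smul_mul_smul_comm, h, mul_one, one_mul, RCLike.star_def, Complex.mul_conj']
  module

/-- The Möbius transformation at time `s` applied to `U`. -/
noncomputable def flowOp (c s : ℂ) (U : SelfAdjointGrassmannian H) : H →L[ℂ] H :=
  1 + (s * (1 - c)) • (Ring.inverse (flowDen c s U) * (U.op - 1))

lemma flowDen_add (c s : ℂ) (U : SelfAdjointGrassmannian H) :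
    flowDen c s U + (s * (1 - c)) • (U.op - 1) = flowNum c s U := by
  simp only [flowDen, flowNum, Algebra.algebraMap_eq_smul_one]
  module

lemma flowDen_eq (c s : ℂ) (U : SelfAdjointGrassmannian H) :
    flowDen c s U = (1 - s) • U.op - algebraMap ℂ _ (c - s) := by
  simp only [flowDen, Algebra.algebraMap_eq_smul_one]
  module

lemma IsCut.flowOp_eq {c : ℂ} {U : SelfAdjointGrassmannian H} (h : IsCut c U) (s : I) :
    flowOp c (s : ℝ) U = Ring.inverse (flowDen c (s : ℝ) U) * flowNum c (s : ℝ) U := by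
  rw [← flowDen_add, mul_add, Ring.inverse_mul_cancel _ (h.isUnit_flowDen s), mul_smul_comm, flowOp]

lemma IsCut.flowOp_eq' {c : ℂ} {U : SelfAdjointGrassmannian H} (h : IsCut c U) (s : I) :
    flowOp c (s : ℝ) U = flowNum c (s : ℝ) U * Ring.inverse (flowDen c (s : ℝ) U) := by
  have hc : Commute (U.op - 1) (Ring.inverse (flowDen c (s : ℝ) U)) := by
    have h1 : Commute (U.op - 1) (flowDen c (s : ℝ) U) :=
      (commute_flowDen_op c (s : ℝ) U).symm.sub_left (Commute.one_left _)
    obtain ⟨u, hu⟩ := h.isUnit_flowDen s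
    rw [← hu] at h1 ⊢
    rw [Ring.inverse_unit]
    exact h1.units_inv_right
  rw [← flowDen_add, add_mul, Ring.mul_inverse_cancel _ (h.isUnit_flowDen s), smul_mul_assoc,
    flowOp, hc.eq]

lemma IsCut.conj_mul_self {c : ℂ} {U : SelfAdjointGrassmannian H} (h : IsCut c U) :
    starRingEnd ℂ c * c = 1 := by
  rw [Complex.conj_mul', h.norm_eq_one]; simp

/-- The coefficients of numerator and denominator satisfy the relations that make the Möbius
transformation preserve the unit circle. -/
lemma IsCut.flow_coeffs {c : ℂ} {U : SelfAdjointGrassmannian H} (h : IsCut c U) (s : ℝ) :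
    (‖1 - c * s‖ ^ 2 + ‖c * (1 - s)‖ ^ 2 : ℂ) = ‖(1 - s : ℂ)‖ ^ 2 + ‖c - s‖ ^ 2 ∧
    starRingEnd ℂ (1 - c * s) * (c * (1 - s)) = starRingEnd ℂ (1 - s : ℂ) * (c - s) := by
  have hc := h.conj_mul_self
  constructor
  · simp only [← Complex.conj_mul']
    simp only [map_sub, map_mul, map_one, Complex.conj_ofReal]
    linear_combination (s ^ 2 + (1 - s) ^ 2 - 1 : ℂ) * hc
  · simp only [map_sub, map_mul, map_one, Complex.conj_ofReal]
    linear_combination (-s * (1 - s) : ℂ) * hc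

lemma IsCut.flowOp_mem_unitary {c : ℂ} {U : SelfAdjointGrassmannian H} (h : IsCut c U) (s : I) :
    flowOp c (s : ℝ) U ∈ unitary (H →L[ℂ] H) := by
  obtain ⟨h1, h2⟩ := h.flow_coeffs s
  have h3 := congrArg (starRingEnd ℂ) h2
  simp only [map_mul, Complex.conj_conj] at h3
  have hu := h.isUnit_flowDen s
  rw [Unitary.mem_iff]
  constructor
  · have h4 : star (flowNum c (s : ℝ) U) * flowNum c (s : ℝ) U
        = star (flowDen c (s : ℝ) U) * flowDen c (s : ℝ) U := by
      rw [flowDen_eq, flowNum, star_mul_self_linear, star_mul_self_linear, h1, h2, map_mul,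
        mul_comm _ (1 - c * _), h3, mul_comm]
    rw [h.flowOp_eq', star_mul, mul_assoc, ← mul_assoc (star (flowNum _ _ _)), h4, mul_assoc,
      Ring.mul_inverse_cancel _ hu, mul_one, ← star_mul, Ring.mul_inverse_cancel _ hu, star_one]
  · have h4 : flowNum c (s : ℝ) U * star (flowNum c (s : ℝ) U)
        = flowDen c (s : ℝ) U * star (flowDen c (s : ℝ) U) := by
      rw [flowDen_eq, flowNum, self_mul_star_linear, self_mul_star_linear, h1, h2, map_mul,
        mul_comm _ (1 - c * _), h3, mul_comm]
    rw [h.flowOp_eq, star_mul, mul_assoc, ← mul_assoc (flowNum _ _ _), h4, mul_assoc,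
      ← star_mul, Ring.inverse_mul_cancel _ hu, star_one, mul_one, Ring.inverse_mul_cancel _ hu]

/-- The contraction to `1` of the set of all `U` whose spectrum misses `c`: the spectrum is moved
along the unit circle, away from `c` towards `1`, by a hyperbolic Möbius transformation. -/
noncomputable def flow (c : ℂ) (s : I) (U : SelfAdjointGrassmannian H) (h : IsCut c U) :
    SelfAdjointGrassmannian H :=
  ⟨⟨flowOp c (s : ℝ) U, h.flowOp_mem_unitary s⟩, by
    have : flowOp c (s : ℝ) U - 1 =
        ((s : ℝ) * (1 - c) : ℂ) • (Ring.inverse (flowDen c (s : ℝ) U) * (U.op - 1)) :=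
      add_sub_cancel_left _ _
    change IsHilbertSchmidt (flowOp c (s : ℝ) U - 1)
    rw [this]
    exact (U.isHilbertSchmidt.comp_left _).smul _⟩

lemma op_flow (c : ℂ) (s : I) (U : SelfAdjointGrassmannian H) (h : IsCut c U) :
    (flow c s U h).op = flowOp c (s : ℝ) U := rfl

lemma toLp_flow (c : ℂ) (s : I) (U : SelfAdjointGrassmannian H) (h : IsCut c U) :
    (flow c s U h).toLp =
      ((s : ℝ) * (1 - c) : ℂ) • leftMul (Ring.inverse (flowDen c (s : ℝ) U)) U.toLp := by
  rw [HSSpace.ext_iff_apply]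
  intro i
  simp [op_flow, flowOp]

@[simp]
lemma flow_zero (c : ℂ) (U : SelfAdjointGrassmannian H) (h : IsCut c U) : flow c 0 U h = 1 := by
  apply op_injective
  simp [op_flow, flowOp]

@[simp]
lemma flow_one (c : ℂ) (U : SelfAdjointGrassmannian H) (h : IsCut c U) : flow c 1 U h = U := by
  apply op_injective
  have h1 : flowDen c 1 U = algebraMap ℂ _ (1 - c) := by
    rw [flowDen, map_sub, map_one]
    simp
  have hc : (1 - c) ≠ 0 := sub_ne_zero.2 h.ne_one.symm
  have h2 : Ring.inverse (flowDen c 1 U) = algebraMap ℂ _ (1 - c)⁻¹ := by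
    have hu := h.isUnit_flowDen 1
    simp only [Set.Icc.coe_one, Complex.ofReal_one] at hu
    rw [← mul_one (Ring.inverse _), Ring.inverse_mul_eq_iff_eq_mul _ _ _ hu, h1, ← map_mul,
      mul_inv_cancel₀ hc, map_one]
  simp only [op_flow, flowOp, Set.Icc.coe_one, Complex.ofReal_one, h2, one_mul,
    Algebra.algebraMap_eq_smul_one, smul_mul_assoc, smul_smul, mul_inv_cancel₀ hc, one_smul]
  abel

lemma continuous_flow {Y : Type*} [TopologicalSpace Y] {c : Y → ℂ} {s : Y → I}
    {U : Y → SelfAdjointGrassmannian H} (hc : Continuous c) (hs : Continuous s)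
    (hU : Continuous U) (h : ∀ y, IsCut (c y) (U y)) :
    Continuous fun y => flow (c y) (s y) (U y) (h y) := by
  rw [continuous_iff_toLp]
  simp only [toLp_flow]
  have hop := continuous_op.comp hU
  have hLp := continuous_toLp.comp hU
  have hD : Continuous fun y => flowDen (c y) ((s y : ℝ) : ℂ) (U y) := by
    have h1 := (continuous_algebraMap ℂ (H →L[ℂ] H)).comp hc
    have h2 : Continuous fun y => ((s y : ℝ) : ℂ) := by fun_prop
    exact (hop.sub h1).sub (h2.smul (hop.sub continuous_const))
  have hR : Continuous fun y => Ring.inverse (flowDen (c y) ((s y : ℝ) : ℂ) (U y)) := by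
    refine continuous_iff_continuousAt.2 fun y => ?_
    obtain ⟨u, hu⟩ := (h y).isUnit_flowDen (s y)
    have := NormedRing.inverse_continuousAt u
    rw [hu] at this
    exact ContinuousAt.comp (f := fun y => flowDen (c y) ((s y : ℝ) : ℂ) (U y)) this hD.continuousAt
  have h3 : Continuous fun y => (((s y : ℝ) : ℂ) * (1 - c y)) := by fun_prop
  exact h3.smul ((leftMul.continuous.comp hR).clm_apply hLp)

end SelfAdjointGrassmannian

namespace SelfAdjointGrassmannian

variable {H : Type*} [NormedAddCommGroup H] [InnerProductSpace ℂ H]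

/-! ### Rotation of one eigenvector -/

open InnerProductSpace in
/-- The unitary operator that multiplies the unit vector `v` by `z` and fixes its orthogonal
complement. -/
noncomputable def rotation (v : H) (z : Circle) : H →L[ℂ] H :=
  1 + ((z : ℂ) - 1) • rankOne ℂ v v

lemma rotation_apply (v : H) (z : Circle) (x : H) :
    rotation v z x = x + (((z : ℂ) - 1) * inner ℂ v x) • v := by
  simp [rotation, mul_smul]

lemma rotation_mul (v : H) (hv : ‖v‖ = 1) (z w : Circle) :
    rotation v z * rotation v w = rotation v (z * w) := by
  ext x
  have h : inner ℂ v v = (1 : ℂ) := by rw [inner_self_eq_norm_sq_to_K, hv]; simp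
  simp only [mul_apply_eq_comp, rotation_apply, inner_add_right, inner_smul_right, h,
    Circle.coe_mul]
  module

lemma rotation_one (v : H) : rotation v 1 = 1 := by
  simp [rotation]

variable [CompleteSpace H]

lemma star_rotation (v : H) (z : Circle) : star (rotation v z) = rotation v z⁻¹ := by
  simp only [rotation, star_add, star_one, star_smul, ContinuousLinearMap.star_eq_adjoint,
    InnerProductSpace.adjoint_rankOne, star_sub, Circle.coe_inv_eq_conj, RCLike.star_def]

lemma rotation_mem_unitary (v : H) (hv : ‖v‖ = 1) (z : Circle) :
    rotation v z ∈ unitary (H →L[ℂ] H) := by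
  rw [Unitary.mem_iff, star_rotation, rotation_mul v hv, rotation_mul v hv]
  simp [rotation_one]

/-- `U` composed with the rotation by `z` in the direction of the unit vector `v`. -/
noncomputable def twist (U : SelfAdjointGrassmannian H) (v : H) (hv : ‖v‖ = 1) (z : Circle) :
    SelfAdjointGrassmannian H :=
  ⟨⟨U.op * rotation v z, mul_mem U.op_mem_unitary (rotation_mem_unitary v hv z)⟩, by
    have : U.op * rotation v z - 1 =
        (U.op - 1) + ((z : ℂ) - 1) • (U.op * InnerProductSpace.rankOne ℂ v v) := by
      rw [rotation, mul_add, mul_one, mul_smul_comm]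
      abel
    change IsHilbertSchmidt (U.op * rotation v z - 1)
    rw [this]
    exact U.isHilbertSchmidt.add (((isHilbertSchmidt_rankOne v v).comp_left _).smul _)⟩

lemma op_twist (U : SelfAdjointGrassmannian H) (v : H) (hv : ‖v‖ = 1) (z : Circle) :
    (U.twist v hv z).op = U.op * rotation v z := rfl

lemma op_twist_apply (U : SelfAdjointGrassmannian H) (v : H) (hv : ‖v‖ = 1) (z : Circle) (x : H) :
    (U.twist v hv z).op x = U.op x + (((z : ℂ) - 1) * inner ℂ v x) • U.op v := by
  rw [op_twist, mul_apply_eq_comp, rotation_apply, map_add, map_smul]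

lemma toLp_twist (U : SelfAdjointGrassmannian H) (v : H) (hv : ‖v‖ = 1) (z : Circle) :
    (U.twist v hv z).toLp = U.toLp + ((z : ℂ) - 1) • leftMul U.op (rankOneHS v v) := by
  rw [HSSpace.ext_iff_apply]
  intro i
  rw [lp.coeFn_add, Pi.add_apply, lp.coeFn_smul, Pi.smul_apply, leftMul_apply, rankOneHS_apply,
    toLp_apply, toLp_apply, sub_apply, sub_apply, op_twist_apply, map_smul, mul_smul]
  abel

lemma twist_one (U : SelfAdjointGrassmannian H) (v : H) (hv : ‖v‖ = 1) : U.twist v hv 1 = U :=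
  op_injective (by rw [op_twist, rotation_one, mul_one])

lemma twist_twist (U : SelfAdjointGrassmannian H) (v : H) (hv : ‖v‖ = 1) (z w : Circle) :
    (U.twist v hv z).twist v hv w = U.twist v hv (z * w) :=
  op_injective (by rw [op_twist, op_twist, op_twist, mul_assoc, rotation_mul v hv])

lemma continuous_twist {Y : Type*} [TopologicalSpace Y] {U : Y → SelfAdjointGrassmannian H}
    {v : Y → H} {z : Y → Circle} (hU : Continuous U) (hv : Continuous v) (hz : Continuous z)
    (h : ∀ y, ‖v y‖ = 1) : Continuous fun y => (U y).twist (v y) (h y) (z y) := by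
  rw [continuous_iff_toLp]
  simp only [toLp_twist]
  have h1 := leftMul.continuous.comp (continuous_op.comp hU)
  have h2 : Continuous fun y => ((z y : ℂ) - 1) := by fun_prop
  exact (continuous_toLp.comp hU).add (h2.smul (h1.clm_apply (continuous_rankOneHS.comp hv)))

lemma inner_eq_zero_of_mem_eig (U : SelfAdjointGrassmannian H) {z w : ℂ} (h : z ≠ w) {x y : H}
    (hx : x ∈ U.eig z) (hy : y ∈ U.eig w) : inner ℂ x y = 0 :=
  U.orthogonalFamily_eig h ⟨x, hx⟩ ⟨y, hy⟩

lemma mem_eig_twist (U : SelfAdjointGrassmannian H) {v : H} (hv : ‖v‖ = 1) {μ : ℂ}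
    (hμ : v ∈ U.eig μ) (z : Circle) : v ∈ (U.twist v hv z).eig (z * μ) := by
  have h : inner ℂ v v = (1 : ℂ) := by rw [inner_self_eq_norm_sq_to_K, hv]; simp
  rw [mem_eig, op_twist_apply, U.mem_eig.1 hμ, h]
  module

lemma op_twist_of_inner_eq_zero (U : SelfAdjointGrassmannian H) {v : H} (hv : ‖v‖ = 1)
    (z : Circle) {x : H} (hx : inner ℂ v x = 0) : (U.twist v hv z).op x = U.op x := by
  rw [op_twist_apply, hx]
  simp

/-- Rotating an eigenvector changes no eigenspace except those of the old and the new
eigenvalue. -/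
lemma eig_twist (U : SelfAdjointGrassmannian H) {v : H} (hv : ‖v‖ = 1) {μ : ℂ}
    (hμ : v ∈ U.eig μ) (z : Circle) {w : ℂ} (h1 : w ≠ μ) (h2 : w ≠ z * μ) :
    (U.twist v hv z).eig w = U.eig w := by
  ext x
  constructor
  · intro hx
    have h0 := inner_eq_zero_of_mem_eig _ h2.symm (U.mem_eig_twist hv hμ z) hx
    rw [mem_eig, ← op_twist_of_inner_eq_zero U hv z h0, mem_eig _ |>.1 hx]
  · intro hx
    have h0 := inner_eq_zero_of_mem_eig _ h1.symm hμ hx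
    rw [mem_eig, op_twist_of_inner_eq_zero U hv z h0, mem_eig _ |>.1 hx]

/-- Rotating an eigenvector lowers the multiplicity of its eigenvalue by one. -/
lemma eigenMult_twist (U : SelfAdjointGrassmannian H) {v : H} (hv : ‖v‖ = 1) {μ : ℂ}
    (hμ : v ∈ U.eig μ) {z : Circle} (hz : z ≠ 1) (hμ1 : μ ≠ 1) :
    eigenMult U.op μ = eigenMult (U.twist v hv z).op μ + 1 := by
  have hv0 : v ≠ 0 := fun h => by simp [h] at hv
  have hμ0 : μ ≠ 0 := fun h => by
    have := U.norm_eq_one_of_mem_eig hμ hv0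
    simp [h] at this
  have hzμ : (z : ℂ) * μ ≠ μ := fun h => hz (Circle.ext (by
    simpa using (mul_eq_right₀ hμ0).1 h))
  have hE : (U.twist v hv z).eig μ = (ℂ ∙ v)ᗮ ⊓ U.eig μ := by
    ext x
    rw [Submodule.mem_inf, Submodule.mem_orthogonal_singleton_iff_inner_right]
    constructor
    · intro hx
      have h0 := inner_eq_zero_of_mem_eig _ hzμ (U.mem_eig_twist hv hμ z) hx
      refine ⟨h0, ?_⟩
      rw [mem_eig, ← op_twist_of_inner_eq_zero U hv z h0, mem_eig _ |>.1 hx]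
    · rintro ⟨h0, hx⟩
      rw [mem_eig, op_twist_of_inner_eq_zero U hv z h0, mem_eig _ |>.1 hx]
  have := U.finiteDimensional_eig hμ1
  have h := Submodule.finrank_add_inf_finrank_orthogonal (K₁ := ℂ ∙ v) (K₂ := U.eig μ)
    ((Submodule.span_singleton_le_iff_mem _ _).2 hμ)
  rw [finrank_span_singleton hv0, ← hE] at h
  rw [eigenMult, eigenMult, ← h, add_comm]

/-- If `v` is an eigenvector of `U`, then rotating it keeps every cut that differs from its old and
its new eigenvalue. -/
lemma IsCut.twist {c : ℂ} {U : SelfAdjointGrassmannian H} (h : IsCut c U) {v : H} (hv : ‖v‖ = 1)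
    {μ : ℂ} (hμ : v ∈ U.eig μ) (z : Circle) (hc : c ≠ z * μ) : IsCut c (U.twist v hv z) := by
  have hcμ : c ≠ μ := by
    rintro rfl
    have := (U.mem_spectrum_iff h.ne_one).not.1 h.notMem
    rw [not_not] at this
    rw [this, Submodule.mem_bot] at hμ
    simp [hμ] at hv
  refine ⟨h.norm_eq_one, h.ne_one, ?_⟩
  rw [mem_spectrum_iff _ h.ne_one, U.eig_twist hv hμ z hcμ hc, ← mem_spectrum_iff _ h.ne_one]
  exact h.notMem

end SelfAdjointGrassmannian

/-! ### Singular cocycles and homotopies -/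

section Cocycle

variable {X : Type*} [TopologicalSpace X] {A : Type*} [AddCommGroup A] {c : C(I, X) → A}

/-- The cocycle condition on the singular 2-simplex `x ↦ P (x₀ a₀ + x₁ a₁ + x₂ a₂)`, with the edges
given as curves that agree with those of the simplex. -/
lemma cocycle_affine {E : Type*} [AddCommGroup E] [Module ℝ E] [TopologicalSpace E]
    [ContinuousAdd E] [ContinuousSMul ℝ E] (hc : c ∈ singularCocycles X A) {s : Set E}
    (hs : Convex ℝ s) (P : C(s, X)) (a : Fin 3 → E) (ha : ∀ i, a i ∈ s)
    (e₀₁ e₁₂ e₀₂ : C(I, X))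
    (h₀₁ : ∀ t : I, ∀ h, e₀₁ t = P ⟨(1 - (t : ℝ)) • a 0 + (t : ℝ) • a 1, h⟩)
    (h₁₂ : ∀ t : I, ∀ h, e₁₂ t = P ⟨(1 - (t : ℝ)) • a 1 + (t : ℝ) • a 2, h⟩)
    (h₀₂ : ∀ t : I, ∀ h, e₀₂ t = P ⟨(1 - (t : ℝ)) • a 0 + (t : ℝ) • a 2, h⟩) :
    c e₀₁ + c e₁₂ = c e₀₂ := by
  let τ : C(stdSimplex ℝ (Fin 3), X) :=
    P.comp ⟨fun x => ⟨∑ i, x i • a i, hs.sum_mem (fun i _ => x.2.1 i) x.2.2 (fun i _ => ha i)⟩, by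
      refine Continuous.subtype_mk (continuous_finsetSum _ fun i _ => ?_) _
      have : Continuous fun x : stdSimplex ℝ (Fin 3) => x i :=
        (continuous_apply i).comp continuous_subtype_val
      exact this.smul continuous_const⟩
  have key : ∀ (i j : Fin 3) (e : C(I, X)),
      (∀ t : I, ∀ h, e t = P ⟨(1 - (t : ℝ)) • a i + (t : ℝ) • a j, h⟩) →
      τ.comp (simplexEdge i j) = e := by
    intro i j e he
    ext t
    have h1 : ∑ k, (simplexEdge i j t) k • a k = (1 - (t : ℝ)) • a i + (t : ℝ) • a j := by
      change ∑ k, ((1 - (t : ℝ)) * (if k = i then 1 else 0) + (t : ℝ) * (if k = j then 1 else 0)) •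
        a k = _
      simp [add_smul, Finset.sum_add_distrib, ite_smul]
    have h2 : (1 - (t : ℝ)) • a i + (t : ℝ) • a j ∈ s :=
      hs (ha i) (ha j) (by linarith [t.2.2]) t.2.1 (by ring)
    rw [he t h2]
    change P ⟨∑ k, (simplexEdge i j t) k • a k, _⟩ = _
    congr 1
    exact Subtype.ext h1
  have h := hc τ
  rw [key 1 2 e₁₂ h₁₂, key 0 2 e₀₂ h₀₂, key 0 1 e₀₁ h₀₁] at h
  rw [← sub_eq_zero, ← h]
  abel

lemma cocycle_const (hc : c ∈ singularCocycles X A) (x : X) : c (ContinuousMap.const I x) = 0 := by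
  have h := cocycle_affine hc (convex_univ (𝕜 := ℝ) (E := ℝ)) (ContinuousMap.const _ x)
    (fun _ => 0) (fun _ => trivial) (.const I x) (.const I x) (.const I x) (fun _ _ => rfl)
    (fun _ _ => rfl) (fun _ _ => rfl)
  simpa using h

/-- The restriction of a curve on the real line to the (oriented) interval from `a` to `b`. -/
def curveSegment (P : C(ℝ, X)) (a b : ℝ) : C(I, X) :=
  P.comp ⟨fun t : I => (1 - (t : ℝ)) • a + (t : ℝ) • b, by fun_prop⟩

lemma cocycle_segment_add (hc : c ∈ singularCocycles X A) (P : C(ℝ, X)) (a b d : ℝ) :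
    c (curveSegment P a b) + c (curveSegment P b d) = c (curveSegment P a d) :=
  cocycle_affine hc (convex_univ (𝕜 := ℝ) (E := ℝ)) (P.comp ⟨Subtype.val, by fun_prop⟩)
    ![a, b, d] (fun _ => trivial) _ _ _ (fun _ _ => rfl) (fun _ _ => rfl) (fun _ _ => rfl)

/-- A cocycle takes the same value on the two ways around a singular square. -/
lemma cocycle_square (hc : c ∈ singularCocycles X A) (S : C(I × I, X)) (b r l t : C(I, X))
    (hb : ∀ x, b x = S (x, 0)) (hr : ∀ x, r x = S (1, x)) (hl : ∀ x, l x = S (0, x))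
    (ht : ∀ x, t x = S (x, 1)) : c b + c r = c l + c t := by
  let s : Set (ℝ × ℝ) := Set.Icc 0 1 ×ˢ Set.Icc 0 1
  have hs : Convex ℝ s := (convex_Icc 0 1).prod (convex_Icc 0 1)
  let P : C(s, X) := S.comp ⟨fun p => (⟨p.1.1, p.2.1⟩, ⟨p.1.2, p.2.2⟩), by fun_prop⟩
  let d : C(I, X) := S.comp ⟨fun x => (x, x), by fun_prop⟩
  have h1 := cocycle_affine hc hs P ![(0, 0), (1, 0), (1, 1)]
    (fun i => by fin_cases i <;> simp [s]) b r d
    (fun x h => by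
      rw [hb]; exact congrArg S (Prod.ext (Subtype.ext (by simp)) (Subtype.ext (by simp))))
    (fun x h => by
      rw [hr]; exact congrArg S (Prod.ext (Subtype.ext (by simp)) (Subtype.ext (by simp))))
    (fun x h => by
      change S (x, x) = _; exact congrArg S (Prod.ext (Subtype.ext (by simp)) (Subtype.ext (by simp))))
  have h2 := cocycle_affine hc hs P ![(0, 0), (0, 1), (1, 1)]
    (fun i => by fin_cases i <;> simp [s]) l t d
    (fun x h => by
      rw [hl]; exact congrArg S (Prod.ext (Subtype.ext (by simp)) (Subtype.ext (by simp))))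
    (fun x h => by
      rw [ht]; exact congrArg S (Prod.ext (Subtype.ext (by simp)) (Subtype.ext (by simp))))
    (fun x h => by
      change S (x, x) = _; exact congrArg S (Prod.ext (Subtype.ext (by simp)) (Subtype.ext (by simp))))
  rw [h1, h2]

end Cocycle

/-! ### Spectra on arcs of the circle -/

lemma Circle.exp_ne_exp {a b : ℝ} (h0 : 0 < a - b) (h1 : a - b < 2 * Real.pi) :
    Circle.exp a ≠ Circle.exp b := by
  intro h
  obtain ⟨m, hm⟩ := Circle.exp_eq_exp.1 h
  have hpi := Real.pi_pos
  have h2 : (0 : ℝ) < m := by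
    by_contra! h
    nlinarith
  have h3 : (m : ℝ) < 1 := by
    by_contra! h
    nlinarith
  have h4 : (0 : ℤ) < m := by exact_mod_cast h2
  have h5 : m < (1 : ℤ) := by exact_mod_cast h3
  omega

lemma Circle.coe_exp_ne_exp {a b : ℝ} (h0 : 0 < a - b) (h1 : a - b < 2 * Real.pi) :
    (Circle.exp a : ℂ) ≠ Circle.exp b := fun h => Circle.exp_ne_exp h0 h1 (Circle.ext h)

lemma Circle.coe_exp_ne_one {a : ℝ} (h0 : 0 < a) (h1 : a < 2 * Real.pi) :
    (Circle.exp a : ℂ) ≠ 1 := by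
  simpa using Circle.coe_exp_ne_exp (a := a) (b := 0) (by simpa) (by simpa)

namespace SelfAdjointGrassmannian

variable {H : Type u} [NormedAddCommGroup H] [InnerProductSpace ℂ H] [CompleteSpace H]

lemma isCut_exp_iff (U : SelfAdjointGrassmannian H) {θ : ℝ} (h0 : 0 < θ) (h1 : θ < 2 * Real.pi) :
    IsCut (Circle.exp θ) U ↔ U.eig (Circle.exp θ) = ⊥ := by
  have hne := Circle.coe_exp_ne_one h0 h1
  have := U.mem_spectrum_iff hne
  refine ⟨fun h => ?_, fun h => ⟨Circle.norm_coe _, hne, fun h' => this.1 h' h⟩⟩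
  by_contra h'
  exact h.notMem (this.2 h')

lemma eigenMult_exp_eq_zero_iff (U : SelfAdjointGrassmannian H) {θ : ℝ} (h0 : 0 < θ)
    (h1 : θ < 2 * Real.pi) : eigenMult U.op (Circle.exp θ) = 0 ↔ U.eig (Circle.exp θ) = ⊥ := by
  have := U.finiteDimensional_eig (Circle.coe_exp_ne_one h0 h1)
  exact Submodule.finrank_eq_zero

/-- On an arc that avoids `1` there are only finitely many eigenvalues. -/
lemma finite_angles (U : SelfAdjointGrassmannian H) {a b : ℝ} (ha : 0 < a) (hb : b < 2 * Real.pi) :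
    {θ ∈ Set.Icc a b | U.eig (Circle.exp θ) ≠ ⊥}.Finite := by
  obtain ⟨δ, hδ, hmin⟩ := (isCompact_Icc (a := a) (b := b)).exists_forall_le'
    (f := fun θ => ‖(Circle.exp θ : ℂ) - 1‖) (by fun_prop) (a := 0) (fun θ hθ => by
      rw [norm_pos_iff, sub_ne_zero]
      exact Circle.coe_exp_ne_one (ha.trans_le hθ.1) (hθ.2.trans_lt hb))
  refine Set.Finite.of_finite_image (f := fun θ => (Circle.exp θ : ℂ))
    ((U.finite_setOf_eig_ne_bot hδ).subset ?_) ?_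
  · rintro _ ⟨θ, ⟨hθ, hE⟩, rfl⟩
    exact ⟨hmin θ hθ, hE⟩
  · rintro θ ⟨hθ, -⟩ θ' ⟨hθ', -⟩ h
    rcases lt_trichotomy θ θ' with hlt | heq | hlt
    · exact absurd h.symm (Circle.coe_exp_ne_exp (by linarith) (by linarith [hθ.1, hθ'.2]))
    · exact heq
    · exact absurd h (Circle.coe_exp_ne_exp (by linarith) (by linarith [hθ'.1, hθ.2]))

/-- All points of the circle close to `-1`, except possibly `-1`, are cuts. -/
lemma eventually_isCut (U : SelfAdjointGrassmannian H) :
    ∀ᶠ ε in 𝓝[≠] (0 : ℝ), IsCut (Circle.exp (Real.pi + ε)) U := by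
  have hpi := Real.pi_gt_three
  have hfin := U.finite_angles (a := Real.pi - 1) (b := Real.pi + 1) (by linarith) (by linarith)
  have hB : {ε : ℝ | ε ≠ 0 ∧ Real.pi + ε ∈
      {θ ∈ Set.Icc (Real.pi - 1) (Real.pi + 1) | U.eig (Circle.exp θ) ≠ ⊥}}.Finite :=
    (hfin.preimage (f := fun ε => Real.pi + ε) (add_right_injective _).injOn).subset
      fun ε h => h.2
  have h1 := hB.isClosed.isOpen_compl.mem_nhds (x := 0) (by simp)
  have h2 : Set.Ioo (-1 : ℝ) 1 ∈ 𝓝 (0 : ℝ) := Ioo_mem_nhds (by norm_num) (by norm_num)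
  filter_upwards [self_mem_nhdsWithin, nhdsWithin_le_nhds h1, nhdsWithin_le_nhds h2] with ε h h' h''
  rw [isCut_exp_iff U (by linarith [h''.1]) (by linarith [h''.2])]
  by_contra hE
  exact h' ⟨h, ⟨by linarith [h''.1], by linarith [h''.2]⟩, hE⟩

/-- Small arcs around `-1` have cuts as end points. -/
lemma eventually_isCut_pair (U : SelfAdjointGrassmannian H) :
    ∀ᶠ ε in 𝓝[>] (0 : ℝ), IsCut (Circle.exp (Real.pi + ε)) U ∧
      IsCut (Circle.exp (Real.pi - ε)) U := by
  have h1 : ∀ᶠ ε in 𝓝[>] (0 : ℝ), IsCut (Circle.exp (Real.pi + ε)) U :=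
    U.eventually_isCut.filter_mono (nhdsWithin_mono _ fun _ h => ne_of_gt h)
  have h2 : ∀ᶠ ε in 𝓝[>] (0 : ℝ), IsCut (Circle.exp (Real.pi - ε)) U := by
    have : Tendsto (fun ε : ℝ => -ε) (𝓝[>] 0) (𝓝[≠] 0) := by
      refine tendsto_nhdsWithin_iff.2 ⟨?_, ?_⟩
      · have h : Tendsto (fun ε : ℝ => -ε) (𝓝 0) (𝓝 (-0)) := tendsto_id.neg
        rw [neg_zero] at h
        exact h.mono_left nhdsWithin_le_nhds
      · filter_upwards [self_mem_nhdsWithin] with ε hε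
        exact neg_ne_zero.2 (ne_of_gt hε)
    exact this.eventually U.eventually_isCut
  exact h1.and h2

lemma exists_isCut (U : SelfAdjointGrassmannian H) :
    ∃ ε : ℝ, 0 < ε ∧ ε < Real.pi ∧ IsCut (Circle.exp (Real.pi + ε)) U ∧
      IsCut (Circle.exp (Real.pi - ε)) U := by
  obtain ⟨ε, h, h'⟩ := (U.eventually_isCut_pair.and (Ioo_mem_nhdsGT Real.pi_pos)).exists
  exact ⟨ε, h'.1, h'.2, h⟩

/-! ### Cocycles on the self-adjoint Grassmannian -/

/-- The path from `1` to `U` along which the spectrum stays away from `w`. -/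
noncomputable def flowPath (w : ℂ) (U : SelfAdjointGrassmannian H) (h : IsCut w U) :
    C(I, SelfAdjointGrassmannian H) :=
  ⟨fun s => flow w s U h,
    continuous_flow continuous_const continuous_id continuous_const fun _ => h⟩

/-- One full turn of the unit vector `v`, starting at `U`. -/
noncomputable def rotationLoop (U : SelfAdjointGrassmannian H) (v : H) (hv : ‖v‖ = 1) :
    C(I, SelfAdjointGrassmannian H) :=
  ⟨fun s => U.twist v hv (Circle.exp (2 * Real.pi * (s : ℝ))),
    continuous_twist continuous_const continuous_const (by fun_prop) fun _ => hv⟩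

section Cochain

variable {A : Type*} [AddCommGroup A] {c : C(I, SelfAdjointGrassmannian H) → A}

open Classical in
/-- The value of the cochain `c` on the path from `1` to `U` that avoids the cut `w` (`0` if `w` is
not a cut of `U`). On the set of all `U` with the cut `w`, this is a primitive of the cocycle
`c`. -/
noncomputable def primitive (c : C(I, SelfAdjointGrassmannian H) → A) (w : ℂ)
    (U : SelfAdjointGrassmannian H) : A :=
  if h : IsCut w U then c (flowPath w U h) else 0

lemma primitive_of_isCut {w : ℂ} {U : SelfAdjointGrassmannian H} (h : IsCut w U) :
    primitive c w U = c (flowPath w U h) := dif_pos h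

lemma cocycle_eq_primitive_sub (hc : c ∈ singularCocycles _ A) {w : ℂ}
    (p : C(I, SelfAdjointGrassmannian H)) (h : ∀ t, IsCut w (p t)) :
    c p = primitive c w (p 1) - primitive c w (p 0) := by
  have := cocycle_square hc
    ⟨fun x : I × I => flow w x.2 (p x.1) (h x.1), continuous_flow continuous_const continuous_snd
      (p.continuous.comp continuous_fst) fun x => h x.1⟩
    (.const I 1) (flowPath w (p 1) (h 1)) (flowPath w (p 0) (h 0)) p
    (fun x => (flow_zero _ _ (h x)).symm) (fun x => rfl) (fun x => rfl)
    (fun x => (flow_one _ _ (h x)).symm)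
  rw [cocycle_const hc, zero_add] at this
  rw [primitive_of_isCut (h 1), primitive_of_isCut (h 0), this, add_sub_cancel_left]

/-- The primitive does not change when the cut moves without meeting the spectrum. -/
lemma primitive_eq_of_path (hc : c ∈ singularCocycles _ A) {U : SelfAdjointGrassmannian H}
    (w : C(I, ℂ)) (h : ∀ t, IsCut (w t) U) : primitive c (w 1) U = primitive c (w 0) U := by
  have := cocycle_square hc
    ⟨fun x : I × I => flow (w x.1) x.2 U (h x.1),
      continuous_flow (w.continuous.comp continuous_fst) continuous_snd continuous_const
        fun x => h x.1⟩
    (.const I 1) (flowPath (w 1) U (h 1)) (flowPath (w 0) U (h 0)) (.const I U)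
    (fun x => (flow_zero _ _ (h x)).symm) (fun x => rfl) (fun x => rfl)
    (fun x => (flow_one _ _ (h x)).symm)
  rw [cocycle_const hc, cocycle_const hc, zero_add, add_zero] at this
  rw [primitive_of_isCut (h 1), primitive_of_isCut (h 0), this]

/-- All loops that turn one unit vector once are freely homotopic. -/
lemma cocycle_rotationLoop (hc : c ∈ singularCocycles _ A) (U V : SelfAdjointGrassmannian H)
    (v w : H) (hv : ‖v‖ = 1) (hw : ‖w‖ = 1) :
    c (rotationLoop U v hv) = c (rotationLoop V w hw) := by
  have key : ∀ (U : SelfAdjointGrassmannian H) (v : H) (hv : ‖v‖ = 1),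
      c (rotationLoop U v hv) = c (rotationLoop 1 v hv) := by
    intro U v hv
    obtain ⟨ε, -, -, hcut, -⟩ := U.exists_isCut
    let q := flowPath _ U hcut
    have := cocycle_square hc
      ⟨fun x : I × I => (q x.1).twist v hv (Circle.exp (2 * Real.pi * (x.2 : ℝ))),
        continuous_twist (q.continuous.comp continuous_fst) continuous_const (by fun_prop)
          fun _ => hv⟩
      q (rotationLoop U v hv) (rotationLoop 1 v hv) q
      (fun x => by simp [twist_one]) (fun x => by simp [q, flowPath, rotationLoop])
      (fun x => by simp [q, flowPath, rotationLoop]) (fun x => by simp [twist_one])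
    rw [add_comm] at this
    exact add_right_cancel this
  rw [key U v hv, key V w hw]
  have hv0 : v ≠ 0 := fun h => by simp [h] at hv
  have : Nontrivial H := ⟨v, 0, hv0⟩
  have hrank : 1 < Module.rank ℝ H := by
    rw [rank_real_of_complex]
    have : 1 ≤ Module.rank ℂ H := Cardinal.one_le_iff_ne_zero.2 (rank_pos (R := ℂ) (M := H)).ne'
    calc (1 : Cardinal) < 2 * 1 := by norm_num
      _ ≤ 2 * Module.rank ℂ H := by gcongr
  obtain ⟨γ, hγ⟩ := (isPathConnected_sphere hrank (0 : H) zero_le_one).joinedIn v (by simpa) w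
    (by simpa)
  have hγ' : ∀ t, ‖γ t‖ = 1 := fun t => by simpa using hγ t
  have := cocycle_square hc
    ⟨fun x : I × I => (1 : SelfAdjointGrassmannian H).twist (γ x.1) (hγ' x.1)
        (Circle.exp (2 * Real.pi * (x.2 : ℝ))),
      continuous_twist continuous_const (γ.continuous.comp continuous_fst) (by fun_prop)
        fun _ => hγ' _⟩
    (.const I 1) (rotationLoop 1 w hw) (rotationLoop 1 v hv) (.const I 1)
    (fun x => by simp [twist_one]) (fun x => by simp [rotationLoop])
    (fun x => by simp [rotationLoop]) (fun x => by simp [twist_one])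
  rw [cocycle_const hc, zero_add, add_zero] at this
  exact this.symm

/-- When the cut moves anticlockwise across one eigenvalue, the primitive increases by the value of
the cocycle on the loop that turns one vector: the two paths to `U` differ by such a loop. -/
lemma primitive_sub_twist (hc : c ∈ singularCocycles _ A) {U : SelfAdjointGrassmannian H}
    {α α' θ : ℝ} (h0 : 0 < α') (h1 : α' < θ) (h2 : θ < α) (h3 : α < 2 * Real.pi)
    (hα : IsCut (Circle.exp α) U) (hα' : IsCut (Circle.exp α') U) {v : H} (hv : ‖v‖ = 1)
    (hvθ : v ∈ U.eig (Circle.exp θ)) :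
    primitive c (Circle.exp α) U - primitive c (Circle.exp α') U =
      primitive c (Circle.exp α) (U.twist v hv (Circle.exp (-θ)))
        - primitive c (Circle.exp α') (U.twist v hv (Circle.exp (-θ)))
        + c (rotationLoop U v hv) := by
  set W := U.twist v hv (Circle.exp (-θ)) with hW
  have hθ1 : (Circle.exp (-θ) : ℂ) * Circle.exp θ = 1 := by
    rw [← Circle.coe_mul, ← Circle.exp_add, neg_add_cancel, Circle.exp_zero, Circle.coe_one]
  have hWv : v ∈ W.eig 1 := by
    have := U.mem_eig_twist hv hvθ (Circle.exp (-θ))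
    rwa [hθ1] at this
  have hWα : IsCut (Circle.exp α) W := hα.twist hv hvθ _ (by
    rw [hθ1]; exact Circle.coe_exp_ne_one (by linarith) h3)
  have hWα' : IsCut (Circle.exp α') W := hα'.twist hv hvθ _ (by
    rw [hθ1]; exact Circle.coe_exp_ne_one h0 (by linarith))
  -- turning `v` from `1` to its eigenvalue avoids `α` anticlockwise, and `α'` clockwise
  let P : C(ℝ, SelfAdjointGrassmannian H) := ⟨fun τ => W.twist v hv (Circle.exp τ),
    continuous_twist continuous_const continuous_const (by fun_prop) fun _ => hv⟩
  have hP0 : P 0 = W := by simp [P, twist_one]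
  have hPθ : P θ = U := by
    simp only [P, ContinuousMap.coe_mk, hW, twist_twist, ← Circle.exp_add, neg_add_cancel,
      Circle.exp_zero, twist_one]
  have hPθ' : P (θ - 2 * Real.pi) = U := by
    rw [← hPθ]; simp [P]
  have hseg : ∀ (a b : ℝ) (t : I), curveSegment P a b t = P ((1 - (t : ℝ)) * a + (t : ℝ) * b) :=
    fun _ _ _ => rfl
  have e1 := cocycle_eq_primitive_sub hc (w := Circle.exp α) (curveSegment P 0 θ) (fun t => by
    rw [hseg]
    refine hWα.twist hv hWv _ ?_
    rw [mul_one]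
    have ht0 := t.2.1
    have ht1 := t.2.2
    exact Circle.coe_exp_ne_exp (by nlinarith) (by nlinarith))
  have e2 := cocycle_eq_primitive_sub hc (w := Circle.exp α')
    (curveSegment P (θ - 2 * Real.pi) 0) (fun t => by
      rw [hseg]
      refine hWα'.twist hv hWv _ ?_
      rw [mul_one]
      have ht0 := t.2.1
      have ht1 := t.2.2
      exact Circle.coe_exp_ne_exp (by nlinarith) (by nlinarith))
  have e3 := cocycle_segment_add hc P (θ - 2 * Real.pi) 0 θ
  have e4 : curveSegment P (θ - 2 * Real.pi) θ = rotationLoop U v hv := by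
    ext t
    rw [hseg]
    simp only [P, ContinuousMap.coe_mk, hW, twist_twist, ← Circle.exp_add, rotationLoop]
    congr 1
    have : -θ + ((1 - (t : ℝ)) * (θ - 2 * Real.pi) + t * θ) = 2 * Real.pi * t - 2 * Real.pi := by
      ring
    rw [this, Circle.exp_sub_two_pi]
  simp only [hseg, Set.Icc.coe_zero, Set.Icc.coe_one, sub_zero, sub_self, one_mul, zero_mul,
    add_zero, zero_add, hP0, hPθ, hPθ'] at e1 e2
  rw [e4, e1, e2] at e3
  rw [← e3]
  abel

end Cochain

end SelfAdjointGrassmannian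

namespace SelfAdjointGrassmannian

variable {H : Type u} [NormedAddCommGroup H] [InnerProductSpace ℂ H] [CompleteSpace H]

section Cochain

variable {A : Type*} [AddCommGroup A] {c : C(I, SelfAdjointGrassmannian H) → A}

lemma finite_support_eigenMult (U : SelfAdjointGrassmannian H) {a b : ℝ} (ha : 0 < a)
    (hb : b < 2 * Real.pi) :
    (Set.Ico a b ∩ Function.support fun θ : ℝ => eigenMult U.op (Circle.exp θ)).Finite := by
  refine (U.finite_angles ha hb).subset ?_
  rintro θ ⟨hθ, h⟩
  refine ⟨⟨hθ.1, hθ.2.le⟩, fun hE => h ?_⟩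
  exact (U.eigenMult_exp_eq_zero_iff (ha.trans_le hθ.1) (hθ.2.trans hb)).2 hE

/-- The primitives for two cuts differ by the number of eigenvalues between the cuts. -/
lemma primitive_sub_primitive (hc : c ∈ singularCocycles _ A) {n : A}
    (hn : ∀ (U : SelfAdjointGrassmannian H) (v : H) (hv : ‖v‖ = 1), c (rotationLoop U v hv) = n)
    {α α' : ℝ} (h0 : 0 < α') (h1 : α' ≤ α) (h2 : α < 2 * Real.pi) (U : SelfAdjointGrassmannian H)
    (hα : IsCut (Circle.exp α) U) (hα' : IsCut (Circle.exp α') U) :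
    primitive c (Circle.exp α) U - primitive c (Circle.exp α') U =
      (∑ᶠ θ ∈ Set.Ico α' α, eigenMult U.op (Circle.exp θ)) • n := by
  obtain ⟨k, hk⟩ : ∃ k, ∑ᶠ θ ∈ Set.Ico α' α, eigenMult U.op (Circle.exp θ) = k := ⟨_, rfl⟩
  rw [hk]
  induction k generalizing U with
  | zero =>
    have hzero : ∀ θ ∈ Set.Ico α' α, eigenMult U.op (Circle.exp θ) = 0 := by
      rw [← finsum_mem_inter_support, finsum_mem_eq_finite_toFinset_sum _
        (U.finite_support_eigenMult h0 h2), Finset.sum_eq_zero_iff] at hk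
      intro θ hθ
      by_contra hne
      exact hne (hk θ (by simp only [Set.Finite.mem_toFinset]; exact ⟨hθ, hne⟩))
    have hcut : ∀ θ ∈ Set.Icc α' α, IsCut (Circle.exp θ) U := by
      intro θ hθ
      rcases eq_or_lt_of_le hθ.2 with rfl | hlt
      · exact hα
      · rw [U.isCut_exp_iff (h0.trans_le hθ.1) (hlt.trans h2),
          ← U.eigenMult_exp_eq_zero_iff (h0.trans_le hθ.1) (hlt.trans h2)]
        exact hzero θ ⟨hθ.1, hlt⟩
    let w : C(I, ℂ) :=
      ⟨fun t : I => (Circle.exp ((1 - (t : ℝ)) * α' + t * α) : ℂ), by fun_prop⟩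
    have hw0 : w 0 = Circle.exp α' := by simp [w]
    have hw1 : w 1 = Circle.exp α := by simp [w]
    have := primitive_eq_of_path hc (U := U) w (fun t =>
        hcut _ (by
          have ht0 := t.2.1
          have ht1 := t.2.2
          constructor <;> nlinarith))
    rw [hw0, hw1] at this
    rw [this, sub_self, zero_smul]
  | succ k ih =>
    obtain ⟨θ, hθ, hne⟩ : ∃ θ ∈ Set.Ico α' α, eigenMult U.op (Circle.exp θ) ≠ 0 := by
      by_contra! hall
      rw [finsum_mem_congr rfl hall, finsum_mem_zero] at hk
      omega
    have hθ0 : 0 < θ := h0.trans_le hθ.1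
    have hθ2 : θ < 2 * Real.pi := hθ.2.trans h2
    have hE : U.eig (Circle.exp θ) ≠ ⊥ := (U.eigenMult_exp_eq_zero_iff hθ0 hθ2).not.1 hne
    have hlt : α' < θ := by
      refine lt_of_le_of_ne hθ.1 ?_
      rintro rfl
      exact hE ((U.isCut_exp_iff hθ0 hθ2).1 hα')
    obtain ⟨x, hx, hx0⟩ := Submodule.exists_mem_ne_zero_of_ne_bot hE
    set v : H := (‖x‖⁻¹ : ℂ) • x with hvdef
    have hv : ‖v‖ = 1 := norm_smul_inv_norm hx0
    have hvθ : v ∈ U.eig (Circle.exp θ) := Submodule.smul_mem _ _ hx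
    rw [primitive_sub_twist hc h0 hlt hθ.2 h2 hα hα' hv hvθ, hn]
    set W := U.twist v hv (Circle.exp (-θ)) with hW
    have hθ1 : (Circle.exp (-θ) : ℂ) * Circle.exp θ = 1 := by
      rw [← Circle.coe_mul, ← Circle.exp_add, neg_add_cancel, Circle.exp_zero, Circle.coe_one]
    have hz : Circle.exp (-θ) ≠ 1 := by
      intro h
      rw [h, Circle.coe_one, one_mul] at hθ1
      exact Circle.coe_exp_ne_one hθ0 hθ2 hθ1
    have hmult : ∀ τ ∈ Set.Ico α' α, eigenMult U.op (Circle.exp τ) =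
        eigenMult W.op (Circle.exp τ) + if τ = θ then 1 else 0 := by
      intro τ hτ
      have hτ1 := Circle.coe_exp_ne_one (h0.trans_le hτ.1) (hτ.2.trans h2)
      split_ifs with h
      · rw [h]
        exact U.eigenMult_twist hv hvθ hz (Circle.coe_exp_ne_one hθ0 hθ2)
      · have hne : (Circle.exp τ : ℂ) ≠ Circle.exp θ := by
          rcases lt_or_gt_of_ne h with h | h
          · exact (Circle.coe_exp_ne_exp (by linarith) (by linarith [hτ.1])).symm
          · exact Circle.coe_exp_ne_exp (by linarith) (by linarith [hτ.2])
        rw [add_zero, eigenMult, eigenMult]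
        exact congrArg (fun E : Submodule ℂ H => Module.finrank ℂ E)
          (U.eig_twist hv hvθ _ hne (by rw [hθ1]; exact hτ1)).symm
    have hsum : ∑ᶠ τ ∈ Set.Ico α' α, eigenMult U.op (Circle.exp τ) =
        ∑ᶠ τ ∈ Set.Ico α' α, eigenMult W.op (Circle.exp τ) + 1 := by
      rw [finsum_mem_congr rfl hmult, finsum_mem_add_distrib' (W.finite_support_eigenMult h0 h2)]
      · congr 1
        rw [finsum_mem_inter_support_eq' (fun τ => if τ = θ then 1 else 0) (Set.Ico α' α) {θ},
          finsum_mem_singleton, if_pos rfl]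
        intro τ h
        have h' : τ = θ := by simpa using h
        simpa [h'] using hθ
      · refine (Set.finite_singleton θ).subset ?_
        rintro τ ⟨-, h⟩
        by_contra h'
        exact h (by simpa using h')
    rw [ih W (hα.twist hv hvθ _ (by rw [hθ1]; exact hα.ne_one))
      (hα'.twist hv hvθ _ (by rw [hθ1]; exact hα'.ne_one)) (by omega), succ_nsmul]

/-- The primitive for a cut just past `-1`, corrected by the number of eigenvalues between `-1` and the
cut, does not depend on the cut. -/
lemma primitive_sub_arcCount (hc : c ∈ singularCocycles _ A) {n : A}
    (hn : ∀ (U : SelfAdjointGrassmannian H) (v : H) (hv : ‖v‖ = 1), c (rotationLoop U v hv) = n)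
    (U : SelfAdjointGrassmannian H) {ε ε' : ℝ} (h0 : 0 < ε) (h1 : ε ≤ ε') (h2 : ε' < Real.pi)
    (h : IsCut (Circle.exp (Real.pi + ε)) U) (h' : IsCut (Circle.exp (Real.pi + ε')) U) :
    primitive c (Circle.exp (Real.pi + ε')) U - arcCount U ε' • n =
      primitive c (Circle.exp (Real.pi + ε)) U - arcCount U ε • n := by
  have hpi := Real.pi_pos
  have hj := primitive_sub_primitive hc hn (by linarith) (by linarith) (by linarith) U h' h
  have hk : arcCount U ε' = arcCount U ε +
      ∑ᶠ θ ∈ Set.Ico (Real.pi + ε) (Real.pi + ε'), eigenMult U.op (Circle.exp θ) := by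
    rw [arcCount, arcCount, ← Set.Ico_union_Ico_eq_Ico (b := Real.pi + ε) (by linarith)
      (by linarith)]
    refine finsum_mem_union' ?_ (U.finite_support_eigenMult hpi (by linarith))
      (U.finite_support_eigenMult (by linarith) (by linarith))
    exact Set.Ico_disjoint_Ico_same
  rw [hk, add_smul, ← hj]
  abel

/-- A singular 1-cocycle of the self-adjoint Grassmannian is, up to a coboundary, a multiple of the
number of crossings through `-1`. -/
theorem exists_cocycle_eq (hc : c ∈ singularCocycles _ A) {n : A}
    (hn : ∀ (U : SelfAdjointGrassmannian H) (v : H) (hv : ‖v‖ = 1), c (rotationLoop U v hv) = n) :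
    ∃ G : SelfAdjointGrassmannian H → A,
      (∀ p ν, IsCrossingNumber p ν → c p = G (p 1) - G (p 0) + ν • n) ∧
      ∀ p : C(I, SelfAdjointGrassmannian H), (∀ t, p t ∉ cayleySubmanifold H) →
        c p = G (p 1) - G (p 0) := by
  have hpi := Real.pi_pos
  -- the primitive for a cut just past `-1`, extended across the jump at `-1`
  choose δ hδ0 hδπ hδ using fun U : SelfAdjointGrassmannian H => U.exists_isCut
  let G : SelfAdjointGrassmannian H → A := fun U =>
    primitive c (Circle.exp (Real.pi + δ U)) U - arcCount U (δ U) • n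
  have hG : ∀ (U : SelfAdjointGrassmannian H) (ε : ℝ), 0 < ε → ε < Real.pi →
      IsCut (Circle.exp (Real.pi + ε)) U →
      G U = primitive c (Circle.exp (Real.pi + ε)) U - arcCount U ε • n := by
    intro U ε h0 h1 h
    rcases le_total ε (δ U) with hle | hle
    · exact primitive_sub_arcCount hc hn U h0 hle (hδπ U) h (hδ U).1
    · exact (primitive_sub_arcCount hc hn U (hδ0 U) hle h1 (hδ U).1 h).symm
  refine ⟨G, ?_, ?_⟩
  · rintro p ν ⟨N, t, ε, hmono, ht0, htN, hε, rfl⟩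
    let P : C(ℝ, SelfAdjointGrassmannian H) :=
      p.comp ⟨Set.projIcc 0 1 zero_le_one, continuous_projIcc⟩
    have hP : ∀ s : I, P s = p s := fun s => congrArg p (Set.projIcc_val zero_le_one s)
    have hseg : ∀ (a b : ℝ) (s : I), curveSegment P a b s = P ((1 - (s : ℝ)) * a + (s : ℝ) * b) :=
      fun _ _ _ => rfl
    have hstep : ∀ j < N, c (curveSegment P (t j) (t (j + 1))) = G (p (t (j + 1))) - G (p (t j)) +
        ((arcCount (p (t (j + 1))) (ε j) : ℤ) - (arcCount (p (t j)) (ε j) : ℤ)) • n := by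
      intro j hj
      obtain ⟨h0, h1, hs⟩ := hε j hj
      have hle : (t j : ℝ) ≤ t (j + 1) := hmono (Nat.le_succ j)
      have hcut : ∀ s ∈ Set.Icc (t j) (t (j + 1)), IsCut (Circle.exp (Real.pi + ε j)) (p s) :=
        fun s hs' => ⟨Circle.norm_coe _, Circle.coe_exp_ne_one (by linarith) (by linarith),
          (hs s hs').1⟩
      have e1 := cocycle_eq_primitive_sub hc (curveSegment P (t j) (t (j + 1)))
        (w := Circle.exp (Real.pi + ε j)) (fun s => by
          have hs0 := s.2.1
          have hs1 := s.2.2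
          have hm0 : (t j : ℝ) ≤ (1 - (s : ℝ)) * t j + s * t (j + 1) := by nlinarith
          have hm1 : (1 - (s : ℝ)) * t j + s * t (j + 1) ≤ (t (j + 1) : ℝ) := by nlinarith
          have := hcut ⟨(1 - (s : ℝ)) * t j + s * t (j + 1), (t j).2.1.trans hm0,
            hm1.trans (t (j + 1)).2.2⟩ ⟨hm0, hm1⟩
          rwa [← hP] at this)
      simp only [hseg, Set.Icc.coe_zero, Set.Icc.coe_one, sub_zero, sub_self,
        one_mul, zero_mul, add_zero, zero_add, hP] at e1
      rw [e1, hG _ _ h0 h1 (hcut _ ⟨le_rfl, hmono (Nat.le_succ j)⟩),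
        hG _ _ h0 h1 (hcut _ ⟨hmono (Nat.le_succ j), le_rfl⟩), sub_smul, natCast_zsmul,
        natCast_zsmul]
      abel
    have hsum : ∀ m ≤ N, c (curveSegment P (t 0) (t m)) = G (p (t m)) - G (p (t 0)) +
        (∑ j ∈ Finset.range m,
          ((arcCount (p (t (j + 1))) (ε j) : ℤ) - (arcCount (p (t j)) (ε j) : ℤ))) • n := by
      intro m
      induction m with
      | zero =>
        intro _
        have : curveSegment P (t 0) (t 0) = .const I (p (t 0)) := by
          ext s
          rw [hseg, ← add_mul, sub_add_cancel, one_mul, hP]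
          rfl
        simp [this, cocycle_const hc]
      | succ m ih =>
        intro hm
        rw [← cocycle_segment_add hc P _ (t m), ih (by omega), hstep m (by omega),
          Finset.sum_range_succ, add_smul]
        abel
    have hp : curveSegment P (t 0) (t N) = p := by
      ext s
      rw [hseg, ht0, htN, ← hP s]
      simp
    rw [← hp, hsum N le_rfl, hp, ht0, htN]
  · intro p hp
    have hcut : ∀ t, IsCut (Circle.exp Real.pi) (p t) := fun t =>
      ⟨Circle.norm_coe _, Circle.coe_exp_ne_one (by linarith) (by linarith), by
        have := hp t
        simpa [cayleySubmanifold] using this⟩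
    have hG' : ∀ U : SelfAdjointGrassmannian H, IsCut (Circle.exp Real.pi) U →
        G U = primitive c (Circle.exp Real.pi) U := by
      intro U hU
      have := primitive_sub_primitive hc hn hpi (by linarith [hδ0 U]) (by linarith [hδπ U]) U
        (hδ U).1 hU
      change _ - (∑ᶠ θ ∈ Set.Ico Real.pi (Real.pi + δ U), eigenMult U.op (Circle.exp θ)) • n = _
      rw [← this, sub_sub_cancel]
    rw [hG' _ (hcut 1), hG' _ (hcut 0), ← cocycle_eq_primitive_sub hc p hcut]

end Cochain

/-! ### Existence of crossing numbers -/

lemma isOpen_setOf_notMem_spectrum (w : ℂ) : IsOpen {U : SelfAdjointGrassmannian H | w ∉ spectrum ℂ U.op} :=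
  isOpen_notMem_spectrum.preimage (by fun_prop : Continuous fun U => (w, U))

lemma exists_isCrossingNumber (p : C(I, SelfAdjointGrassmannian H)) :
    ∃ n, IsCrossingNumber p n := by
  choose δ hδ0 hδπ hδ hδ' using fun U : SelfAdjointGrassmannian H => U.exists_isCut
  let V : I → Set I := fun s =>
    {t | (Circle.exp (Real.pi + δ (p s)) : ℂ) ∉ spectrum ℂ (p t).op} ∩
      {t | (Circle.exp (Real.pi - δ (p s)) : ℂ) ∉ spectrum ℂ (p t).op}
  obtain ⟨t, ht0, hmono, ⟨N, hN⟩, ht⟩ := exists_monotone_Icc_subset_open_cover_unitInterval (c := V)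
    (fun s => ((isOpen_setOf_notMem_spectrum _).preimage p.continuous).inter
      ((isOpen_setOf_notMem_spectrum _).preimage p.continuous))
    (fun s _ => Set.mem_iUnion.2 ⟨s, (hδ (p s)).notMem, (hδ' (p s)).notMem⟩)
  choose s hs using ht
  exact ⟨_, N, t, fun j => δ (p (s j)), hmono, ht0, hN N le_rfl, fun j _ =>
    ⟨hδ0 _, hδπ _, fun r hr => hs j hr⟩, rfl⟩

end SelfAdjointGrassmannian

/-! ### The logarithm of the regularized determinant -/

section Log

lemma neg_mem_slitPlane_of_norm_eq_one {u : ℂ} (hu : ‖u‖ = 1) (h1 : u ≠ 1) :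
    -u ∈ Complex.slitPlane := by
  rw [Complex.mem_slitPlane_iff]
  by_contra! h
  simp only [Complex.neg_re, Complex.neg_im, neg_eq_zero] at h
  have h2 := Complex.normSq_eq_norm_sq u
  rw [hu, Complex.normSq_apply, h.2] at h2
  have h3 : u.re = 1 := by nlinarith
  exact h1 (Complex.ext (by simpa using h3) (by simpa using h.2))

/-- The plane, cut along the ray from `0` through the point `w` of the unit circle. -/
def cutPlane (w : ℂ) : Set ℂ := {z | -(starRingEnd ℂ w * z) ∈ Complex.slitPlane}

lemma isOpen_cutPlane (w : ℂ) : IsOpen (cutPlane w) :=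
  Complex.isOpen_slitPlane.preimage (by fun_prop)

lemma mem_cutPlane {w z : ℂ} (hw : ‖w‖ = 1) (hz : ‖z‖ = 1) (h : z ≠ w) : z ∈ cutPlane w := by
  refine neg_mem_slitPlane_of_norm_eq_one (by simp [hw, hz]) fun h1 => h ?_
  have h2 : w * starRingEnd ℂ w = 1 := by rw [Complex.mul_conj', hw]; simp
  calc z = (w * starRingEnd ℂ w) * z := by rw [h2, one_mul]
    _ = w * (starRingEnd ℂ w * z) := by ring
    _ = w := by rw [h1, mul_one]

lemma one_mem_cutPlane {w : ℂ} (hw : ‖w‖ = 1) (h : w ≠ 1) : (1 : ℂ) ∈ cutPlane w :=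
  mem_cutPlane hw norm_one h.symm

/-- The function `log z - (z - 1)`, with the branch of the logarithm on the plane cut at `w` that
vanishes at `1`. -/
noncomputable def regLog (w z : ℂ) : ℂ :=
  Complex.log (-(starRingEnd ℂ w * z)) - Complex.log (-(starRingEnd ℂ w)) - (z - 1)

lemma exp_regLog {w z : ℂ} (hw : ‖w‖ = 1) (hz : z ∈ cutPlane w) :
    Complex.exp (regLog w z) = z * Complex.exp (-(z - 1)) := by
  have hw0 : starRingEnd ℂ w ≠ 0 := by
    rw [← norm_pos_iff, RCLike.norm_conj, hw]; exact one_pos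
  rw [regLog, sub_eq_add_neg _ (z - 1), Complex.exp_add, Complex.exp_sub,
    Complex.exp_log (Complex.slitPlane_ne_zero hz), Complex.exp_log (neg_ne_zero.2 hw0)]
  field_simp

lemma regLog_one (w : ℂ) : regLog w 1 = 0 := by simp [regLog]

lemma hasDerivAt_regLog {w z : ℂ} (hz : z ∈ cutPlane w) :
    HasDerivAt (regLog w) (z⁻¹ - 1) z := by
  have h0 := Complex.slitPlane_ne_zero hz
  have hw0 : starRingEnd ℂ w ≠ 0 := fun h => h0 (by simp [h])
  have hz0 : z ≠ 0 := fun h => h0 (by simp [h])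
  have h1 : HasDerivAt (fun z => -(starRingEnd ℂ w * z)) (-(starRingEnd ℂ w)) z := by
    have := ((hasDerivAt_id z).const_mul (starRingEnd ℂ w)).neg
    rw [mul_one] at this
    exact this
  convert! ((h1.clog hz).sub_const (Complex.log (-(starRingEnd ℂ w)))).sub
    ((hasDerivAt_id z).sub_const 1) using 1
  field_simp

/-- The quotient of `regLog w z` by `|z - 1|²` for `z` on the unit circle, where `|z - 1|²` is equal
to `- (z - 1)² / z`; it is continuous because `regLog w` vanishes to second order at `1`. -/
noncomputable def regLogQuot (w z : ℂ) : ℂ := -z * dslope (dslope (regLog w) 1) 1 z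

lemma differentiableOn_regLogQuot {w : ℂ} (hw : ‖w‖ = 1) (h : w ≠ 1) :
    DifferentiableOn ℂ (regLogQuot w) (cutPlane w) := by
  have hn := (isOpen_cutPlane w).mem_nhds (one_mem_cutPlane hw h)
  have h1 : DifferentiableOn ℂ (regLog w) (cutPlane w) := fun z hz =>
    (hasDerivAt_regLog hz).differentiableAt.differentiableWithinAt
  have h2 := (Complex.differentiableOn_dslope hn).2 ((Complex.differentiableOn_dslope hn).2 h1)
  exact differentiableOn_id.neg.mul h2

lemma regLogQuot_mul {w z : ℂ} (hw : ‖w‖ = 1) (h : w ≠ 1) (hz : ‖z‖ = 1) :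
    regLogQuot w z * (‖z - 1‖ ^ 2 : ℝ) = regLog w z := by
  have hd : dslope (regLog w) 1 1 = 0 := by
    rw [dslope_same, (hasDerivAt_regLog (one_mem_cutPlane hw h)).deriv]; simp
  have h1 := sub_smul_dslope (regLog w) 1 z
  have h2 := sub_smul_dslope (dslope (regLog w) 1) 1 z
  rw [regLog_one, sub_zero, smul_eq_mul] at h1
  rw [hd, sub_zero, smul_eq_mul] at h2
  have h3 : starRingEnd ℂ z * z = 1 := by rw [Complex.conj_mul', hz]; simp
  have h4 : ((‖z - 1‖ ^ 2 : ℝ) : ℂ) = (starRingEnd ℂ z - 1) * (z - 1) := by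
    push_cast
    rw [← Complex.conj_mul', map_sub, map_one]
  rw [h4, regLogQuot, ← h1, ← h2]
  linear_combination (-(z - 1) * dslope (dslope (regLog w) 1) 1 z) * h3

end Log

namespace SelfAdjointGrassmannian

variable {H : Type u} [NormedAddCommGroup H] [InnerProductSpace ℂ H] [CompleteSpace H]

/-- The continuous functional calculus acts on an eigenvector through the eigenvalue. -/
lemma cfc_apply_of_mem_eig (U : SelfAdjointGrassmannian H) {z : ℂ} {x : H} (hx : x ∈ U.eig z)
    {h : ℂ → ℂ} (hh : ContinuousOn h (spectrum ℂ U.op)) : cfc h U.op x = h z • x := by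
  rcases eq_or_ne x 0 with rfl | hx0
  · simp
  have hz : z ∈ spectrum ℂ U.op := by
    rcases eq_or_ne z 1 with rfl | h1
    · rw [ContinuousLinearMap.spectrum_eq]
      exact (Module.End.hasEigenvalue_of_hasEigenvector ⟨hx, hx0⟩).mem_spectrum
    · exact (U.mem_spectrum_iff h1).2 ((Submodule.ne_bot_iff _).2 ⟨x, hx, hx0⟩)
  have hU := U.isStarNormal_op
  rw [cfc_apply h U.op hU hh]
  suffices key : ∀ g : C(spectrum ℂ U.op, ℂ), cfcHom hU g x = g ⟨z, hz⟩ • x from key _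
  intro g
  induction g using ContinuousMap.induction_on_of_compact with
  | const r =>
    have : ContinuousMap.const (spectrum ℂ U.op) r = algebraMap ℂ C(spectrum ℂ U.op, ℂ) r := rfl
    rw [this, AlgHomClass.commutes]
    simp [Algebra.algebraMap_eq_smul_one]
  | id =>
    rw [cfcHom_id hU, U.mem_eig.1 hx]
    rfl
  | star_id =>
    rw [map_star, cfcHom_id hU, ContinuousLinearMap.star_eq_adjoint, U.adjoint_op_of_mem_eig hx]
    rfl
  | add f g hf hg =>
    rw [map_add, add_apply, hf, hg, ← add_smul]
    rfl
  | mul f g hf hg =>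
    rw [map_mul, mul_apply_eq_comp, hg, map_smul, hf, smul_smul, mul_comm]
    rfl
  | frequently f hf =>
    refine hf.mem_of_closed (s := {g | cfcHom hU g x = g ⟨z, hz⟩ • x}) (isClosed_eq ?_ ?_)
    · exact (cfcHom_continuous hU).clm_apply continuous_const
    · fun_prop

lemma spectrum_subset_cutPlane {w : ℂ} {U : SelfAdjointGrassmannian H} (h : IsCut w U) :
    spectrum ℂ U.op ⊆ cutPlane w := fun _ hz =>
  mem_cutPlane h.norm_eq_one (U.norm_eq_one_of_mem_spectrum hz) fun hzw => h.notMem (hzw ▸ hz)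

lemma mem_cutPlane_of_mem_eig {w : ℂ} {U : SelfAdjointGrassmannian H} (h : IsCut w U) {z : ℂ}
    {x : H} (hx : x ∈ U.eig z) (hx0 : x ≠ 0) : z ∈ cutPlane w := by
  refine mem_cutPlane h.norm_eq_one (U.norm_eq_one_of_mem_eig hx hx0) ?_
  rintro rfl
  exact h.notMem ((U.mem_spectrum_iff h.ne_one).2 ((Submodule.ne_bot_iff _).2 ⟨x, hx, hx0⟩))

/-- A logarithm of the regularized determinant on the set of all `U` with the cut `w`, written as a
trace: `⟨K, h(U) K⟩` in the Hilbert–Schmidt product, with `h = regLogQuot w`. -/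
noncomputable def regDetLog (w : ℂ) (U : SelfAdjointGrassmannian H) : ℂ :=
  inner ℂ U.toLp (leftMul (cfc (regLogQuot w) U.op) U.toLp)

lemma hasSum_regDetLog {w : ℂ} {U : SelfAdjointGrassmannian H} (h : IsCut w U) :
    HasSum (fun z => (eigenMult (U.op - 1) z : ℂ) * regLog w (1 + z)) (regDetLog w U) := by
  obtain ⟨ι, f, hf, hcard⟩ := U.exists_eigenbasis
  have hcont : ContinuousOn (regLogQuot w) (spectrum ℂ U.op) :=
    (differentiableOn_regLogQuot h.norm_eq_one h.ne_one).continuousOn.mono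
      (spectrum_subset_cutPlane h)
  have h1 := U.hasSum_eigenbasis hf (A := cfc (regLogQuot w) U.op) (h := regLogQuot w)
    fun k => U.cfc_apply_of_mem_eig (hf k) hcont
  have h2 : ∀ k : Σ z, ι z, regLogQuot w k.1 * (‖k.1 - 1‖ ^ 2 : ℝ) = regLog w k.1 := fun k =>
    regLogQuot_mul h.norm_eq_one h.ne_one
      (U.norm_eq_one_of_mem_eig (hf k) (f.orthonormal.ne_zero k))
  simp only [h2] at h1
  have h3 : HasSum (fun z => (eigenMult U.op z : ℂ) * regLog w z) (regDetLog w U) := by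
    refine h1.sigma fun z => ?_
    rcases eq_or_ne z 1 with rfl | hz
    · simp only [regLog_one, mul_zero]
      exact hasSum_zero
    · obtain ⟨hfin, hc⟩ := hcard z hz
      have := Fintype.ofFinite (ι z)
      convert! hasSum_fintype fun _ : ι z => regLog w z using 1
      rw [hc, Finset.sum_const, Finset.card_univ, Nat.card_eq_fintype_card, nsmul_eq_mul]
  simp only [eigenMult_op_sub_one]
  have h4 := (Equiv.addLeft (1 : ℂ)).hasSum_iff.2 h3
  simpa only [Function.comp_def, Equiv.coe_addLeft] using h4

lemma hasProd_regDetFactor {w : ℂ} {U : SelfAdjointGrassmannian H} (h : IsCut w U) :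
    HasProd (regDetFactor U) (Complex.exp (regDetLog w U)) := by
  convert! (hasSum_regDetLog h).cexp using 1
  ext z
  rw [regDetFactor, Function.comp_apply, Complex.exp_nat_mul]
  rcases eq_or_ne (eigenMult (U.op - 1) z) 0 with h0 | h0
  · rw [h0, pow_zero, pow_zero]
  · congr 1
    have hne : U.eig (1 + z) ≠ ⊥ := by
      intro hE
      refine h0 ?_
      rw [eigenMult_op_sub_one, eigenMult]
      exact (congrArg (fun E : Submodule ℂ H => Module.finrank ℂ E) hE).trans (finrank_bot ℂ H)
    obtain ⟨x, hx, hx0⟩ := (Submodule.ne_bot_iff _).1 hne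
    rw [exp_regLog h.norm_eq_one (mem_cutPlane_of_mem_eig h hx hx0), add_sub_cancel_left]

/-- The product that defines the regularized determinant converges. -/
theorem multipliable_regDetFactor (U : SelfAdjointGrassmannian H) :
    Multipliable (regDetFactor U) := by
  obtain ⟨ε, -, -, h, -⟩ := U.exists_isCut
  exact ⟨_, hasProd_regDetFactor h⟩

lemma regDet_eq_exp {w : ℂ} {U : SelfAdjointGrassmannian H} (h : IsCut w U) :
    regDet U = Complex.exp (regDetLog w U) := (hasProd_regDetFactor h).tprod_eq

lemma regDet_ne_zero (U : SelfAdjointGrassmannian H) : regDet U ≠ 0 := by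
  obtain ⟨ε, -, -, h, -⟩ := U.exists_isCut
  rw [regDet_eq_exp h]
  exact Complex.exp_ne_zero _

lemma continuousAt_regDetLog {w : ℂ} {U : SelfAdjointGrassmannian H} (h : IsCut w U) :
    ContinuousAt (regDetLog (H := H) w) U := by
  have hev := isOpen_notMem_spectrum.mem_nhds
    (show (w, U) ∈ {p : ℂ × SelfAdjointGrassmannian H | p.1 ∉ spectrum ℂ p.2.op} from h.notMem)
  rw [nhds_prod_eq] at hev
  obtain ⟨B, hB, N, hN, hBN⟩ := mem_prod_iff.1 hev
  obtain ⟨δ, hδ, hball⟩ := Metric.mem_nhds_iff.1 hB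
  have hs : IsCompact (Metric.sphere (0 : ℂ) 1 \ Metric.ball w δ) :=
    (isCompact_sphere 0 1).diff Metric.isOpen_ball
  have hcfc : ContinuousAt (fun V : SelfAdjointGrassmannian H => cfc (regLogQuot w) V.op) U := by
    refine ContinuousAt.cfc hs (regLogQuot w) continuous_op.continuousAt ?_
      (Eventually.of_forall isStarNormal_op) ?_
    · filter_upwards [hN] with V hV z hz
      refine ⟨by simpa using V.norm_eq_one_of_mem_spectrum hz, fun hzw => ?_⟩
      exact hBN (Set.mk_mem_prod (hball hzw) hV) hz
    · refine (differentiableOn_regLogQuot h.norm_eq_one h.ne_one).continuousOn.mono ?_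
      rintro z ⟨hz, hzw⟩
      refine mem_cutPlane h.norm_eq_one (by simpa using hz) ?_
      rintro rfl
      exact hzw (Metric.mem_ball_self hδ)
  have hLp := (continuous_toLp (H := H)).continuousAt (x := U)
  exact hLp.inner ((leftMul.continuous.continuousAt.comp hcfc).clm_apply hLp)

lemma continuous_regDet : Continuous (regDet (H := H)) := by
  refine continuous_iff_continuousAt.2 fun U => ?_
  obtain ⟨ε, -, -, h, -⟩ := U.exists_isCut
  have h1 : ContinuousAt (fun V => Complex.exp (regDetLog (Circle.exp (Real.pi + ε)) V)) U :=
    (continuousAt_regDetLog h).cexp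
  refine h1.congr ?_
  filter_upwards [(isOpen_setOf_notMem_spectrum _).mem_nhds h.notMem] with V hV
  exact (regDet_eq_exp ⟨h.norm_eq_one, h.ne_one, hV⟩).symm

end SelfAdjointGrassmannian

/-! ### Continuous logarithms -/

section LogLift

/-- A nowhere vanishing continuous function on a convex set has a continuous logarithm with any
prescribed value at one point, and only one. -/
lemma existsUnique_log_lift {E : Type*} [AddCommGroup E] [Module ℝ E] [TopologicalSpace E]
    [IsTopologicalAddGroup E] [ContinuousSMul ℝ E] [LocallyConvexSpace ℝ E] {s : Set E}
    (hs : Convex ℝ s) (f : C(s, ℂ)) (hf : ∀ x, f x ≠ 0) (x₀ : s) {z₀ : ℂ}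
    (hz₀ : Complex.exp z₀ = f x₀) :
    ∃! φ : C(s, ℂ), φ x₀ = z₀ ∧ Complex.exp ∘ φ = f := by
  have := hs.locallyPathConnectedSpace
  have := hs.contractibleSpace ⟨x₀, x₀.2⟩
  have : SimplyConnectedSpace s := inferInstance
  exact Complex.isCoveringMapOn_exp.existsUnique_continuousMap_lifts f hz₀ fun x => hf x

lemma exists_log_lift {E : Type*} [AddCommGroup E] [Module ℝ E] [TopologicalSpace E]
    [IsTopologicalAddGroup E] [ContinuousSMul ℝ E] [LocallyConvexSpace ℝ E] {s : Set E}
    (hs : Convex ℝ s) (f : C(s, ℂ)) (hf : ∀ x, f x ≠ 0) (x₀ : s) :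
    ∃ φ : C(s, ℂ), ∀ x, Complex.exp (φ x) = f x := by
  obtain ⟨φ, ⟨-, h⟩, -⟩ := existsUnique_log_lift hs f hf x₀ (Complex.exp_log (hf x₀))
  exact ⟨φ, fun x => congrFun h x⟩

lemma IsLogLift.sub_eq_sub {f : I → ℂ} {φ ψ : C(I, ℂ)} (hφ : IsLogLift f φ) (hψ : IsLogLift f ψ) :
    φ 1 - φ 0 = ψ 1 - ψ 0 := by
  let F : C(I, ℂ) := ⟨fun t => Complex.exp (φ t), by fun_prop⟩
  obtain ⟨χ, -, hχ⟩ := existsUnique_log_lift (convex_Icc (0 : ℝ) 1) F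
    (fun t => Complex.exp_ne_zero _) 0 (z₀ := φ 0) rfl
  have h1 := hχ φ ⟨rfl, rfl⟩
  have h2 := hχ (ψ + .const I (φ 0 - ψ 0)) ⟨by simp, by
    ext t
    simp only [Function.comp_apply, ContinuousMap.add_apply, ContinuousMap.const_apply,
      Complex.exp_add, Complex.exp_sub, hφ _, hψ _, F, ContinuousMap.coe_mk]
    have : f 0 ≠ 0 := by rw [← hφ 0]; exact Complex.exp_ne_zero _
    field_simp⟩
  have h3 := congrArg (fun g : C(I, ℂ) => g 1) (h1.trans h2.symm)
  simp only [ContinuousMap.add_apply, ContinuousMap.const_apply] at h3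
  rw [h3]
  ring

end LogLift

namespace SelfAdjointGrassmannian

variable {H : Type u} [NormedAddCommGroup H] [InnerProductSpace ℂ H] [CompleteSpace H]

/-- The regularized determinant as a continuous function. -/
noncomputable def regDetMap : C(SelfAdjointGrassmannian H, ℂ) := ⟨regDet, continuous_regDet⟩

lemma exists_isLogLift (p : C(I, SelfAdjointGrassmannian H)) :
    ∃ φ : C(I, ℂ), IsLogLift (fun t => regDet (p t)) φ :=
  exists_log_lift (convex_Icc (0 : ℝ) 1) (regDetMap.comp p) (fun t => regDet_ne_zero (p t)) 0

/-- The variation of the logarithm of the regularized determinant along a curve. -/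
noncomputable def logVariation (p : C(I, SelfAdjointGrassmannian H)) : ℂ :=
  (exists_isLogLift p).choose 1 - (exists_isLogLift p).choose 0

lemma logVariation_eq {p : C(I, SelfAdjointGrassmannian H)} {φ : C(I, ℂ)}
    (h : IsLogLift (fun t => regDet (p t)) φ) : logVariation p = φ 1 - φ 0 :=
  (exists_isLogLift p).choose_spec.sub_eq_sub h

lemma logVariation_mem_singularCocycles :
    logVariation (H := H) ∈ singularCocycles (SelfAdjointGrassmannian H) ℂ := by
  intro s
  obtain ⟨φ, hφ⟩ := exists_log_lift (convex_stdSimplex ℝ (Fin 3)) (regDetMap.comp s)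
    (fun t => regDet_ne_zero (s t)) (simplexEdge 0 1 0)
  have h : ∀ i j, logVariation (s.comp (simplexEdge i j)) =
      φ (simplexEdge i j 1) - φ (simplexEdge i j 0) := fun i j =>
    logVariation_eq (φ := φ.comp (simplexEdge i j)) fun t => hφ _
  have h1 : simplexEdge 0 1 1 = simplexEdge 1 2 0 :=
    Subtype.ext ((simplexEdge_one 0 1).trans (simplexEdge_zero 1 2).symm)
  have h2 : simplexEdge 0 2 1 = simplexEdge 1 2 1 :=
    Subtype.ext ((simplexEdge_one 0 2).trans (simplexEdge_one 1 2).symm)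
  have h3 : simplexEdge 0 2 0 = simplexEdge 0 1 0 :=
    Subtype.ext ((simplexEdge_zero 0 2).trans (simplexEdge_zero 0 1).symm)
  rw [h, h, h, h1, h2, h3]
  ring

lemma argVariation_regDet (p : C(I, SelfAdjointGrassmannian H)) :
    argVariation (fun t => regDet (p t)) = (logVariation p).im := by
  rw [argVariation, dif_pos (exists_isLogLift p)]
  rfl

lemma eig_one_eq_bot {z : ℂ} (hz : z ≠ 1) : (1 : SelfAdjointGrassmannian H).eig z = ⊥ := by
  refine (Submodule.eq_bot_iff _).2 fun x hx => ?_
  rw [mem_eig, op_one, one_apply_eq_self] at hx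
  have h : (1 - z) • x = 0 := by rw [sub_smul, one_smul, ← hx, sub_self]
  exact (smul_eq_zero.1 h).resolve_left (sub_ne_zero.2 hz.symm)

/-- The regularized determinant of the rotation of one unit vector. -/
lemma regDet_twist_one (v : H) (hv : ‖v‖ = 1) (z : Circle) :
    regDet ((1 : SelfAdjointGrassmannian H).twist v hv z) = z * Complex.exp (-((z : ℂ) - 1)) := by
  have hv1 : v ∈ (1 : SelfAdjointGrassmannian H).eig 1 := by simp
  rw [regDet, tprod_eq_mulSingle ((z : ℂ) - 1), regDetFactor, eigenMult_op_sub_one,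
    add_sub_cancel]
  · rcases eq_or_ne z 1 with rfl | hz
    · simp
    have hz' : (z : ℂ) ≠ 1 := fun h => hz (Circle.ext (by simpa using h))
    have hvz : v ∈ ((1 : SelfAdjointGrassmannian H).twist v hv z).eig z := by
      simpa using mem_eig_twist 1 hv hv1 z
    have h1 := eigenMult_twist _ hv hvz (z := z⁻¹) (inv_ne_one.2 hz) hz'
    rw [twist_twist, mul_inv_cancel, twist_one] at h1
    have h2 : eigenMult (1 : SelfAdjointGrassmannian H).op z = 0 :=
      (congrArg (fun E : Submodule ℂ H => Module.finrank ℂ E) (eig_one_eq_bot hz')).trans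
        (finrank_bot ℂ H)
    rw [h1, h2, zero_add, pow_one]
  · intro w hw
    rw [regDetFactor]
    rcases eq_or_ne w 0 with rfl | hw0
    · simp
    have h1 : (1 : ℂ) + w ≠ 1 := by simpa using hw0
    have h2 : (1 : ℂ) + w ≠ z * 1 := fun h => hw (by rw [mul_one] at h; rw [← h]; ring)
    have h3 : eigenMult (((1 : SelfAdjointGrassmannian H).twist v hv z).op - 1) w = 0 := by
      rw [eigenMult_op_sub_one]
      exact (congrArg (fun E : Submodule ℂ H => Module.finrank ℂ E)
        ((eig_twist 1 hv hv1 z h1 h2).trans (eig_one_eq_bot h1))).trans (finrank_bot ℂ H)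
    rw [h3, pow_zero]

lemma logVariation_rotationLoop (U : SelfAdjointGrassmannian H) (v : H) (hv : ‖v‖ = 1) :
    logVariation (rotationLoop U v hv) = 2 * Real.pi * Complex.I := by
  rw [cocycle_rotationLoop logVariation_mem_singularCocycles U 1 v v hv hv]
  let φ : C(I, ℂ) := ⟨fun t => (2 * Real.pi * (t : ℝ) : ℝ) * Complex.I
    - ((Circle.exp (2 * Real.pi * (t : ℝ)) : ℂ) - 1), by fun_prop⟩
  rw [logVariation_eq (φ := φ)]
  · simp [φ]
  · intro t
    simp only [φ, ContinuousMap.coe_mk, rotationLoop, regDet_twist_one, Complex.exp_sub,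
      Circle.coe_exp, Complex.exp_neg, div_eq_mul_inv]

/-! ### The Cayley index -/

/-- The variation of the logarithm of the regularized determinant is `2πi` times the number of
crossings, up to a coboundary. -/
lemma exists_logVariation_eq :
    ∃ G : SelfAdjointGrassmannian H → ℂ,
      (∀ p ν, IsCrossingNumber p ν →
        logVariation p = G (p 1) - G (p 0) + ν * (2 * Real.pi * Complex.I)) ∧
      ∀ p : C(I, SelfAdjointGrassmannian H), (∀ t, p t ∉ cayleySubmanifold H) →
        logVariation p = G (p 1) - G (p 0) := by
  obtain ⟨G, h1, h2⟩ := exists_cocycle_eq logVariation_mem_singularCocycles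
    (logVariation_rotationLoop (H := H))
  exact ⟨G, fun p ν h => by rw [h1 p ν h, zsmul_eq_mul], h2⟩

lemma isCrossingNumber_unique {p : C(I, SelfAdjointGrassmannian H)} {m n : ℤ}
    (hm : IsCrossingNumber p m) (hn : IsCrossingNumber p n) : m = n := by
  obtain ⟨G, hG, -⟩ := exists_logVariation_eq (H := H)
  have h := (hG p m hm).symm.trans (hG p n hn)
  exact_mod_cast mul_right_cancel₀ Complex.two_pi_I_ne_zero (add_left_cancel h)

lemma isCrossingNumber_cayleyCochain (p : C(I, SelfAdjointGrassmannian H)) :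
    IsCrossingNumber p (cayleyCochain H p) := by
  rw [cayleyCochain, dif_pos (exists_isCrossingNumber p)]
  exact (exists_isCrossingNumber p).choose_spec

theorem isCrossingNumber_iff (p : C(I, SelfAdjointGrassmannian H)) (n : ℤ) :
    IsCrossingNumber p n ↔ n = cayleyCochain H p :=
  ⟨fun h => isCrossingNumber_unique h (isCrossingNumber_cayleyCochain p),
    fun h => h ▸ isCrossingNumber_cayleyCochain p⟩

lemma exists_logVariation_eq_cayleyCochain :
    ∃ G : SelfAdjointGrassmannian H → ℂ, ∀ p, logVariation p =
      G (p 1) - G (p 0) + cayleyCochain H p * (2 * Real.pi * Complex.I) := by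
  obtain ⟨G, hG, -⟩ := exists_logVariation_eq (H := H)
  exact ⟨G, fun p => hG p _ (isCrossingNumber_cayleyCochain p)⟩

lemma cayleyCochain_eq_zero {p : C(I, SelfAdjointGrassmannian H)}
    (hp : ∀ t, p t ∉ cayleySubmanifold H) : cayleyCochain H p = 0 := by
  obtain ⟨G, hG, hG'⟩ := exists_logVariation_eq (H := H)
  have h := hG p _ (isCrossingNumber_cayleyCochain p)
  rw [hG' p hp, left_eq_add, mul_eq_zero] at h
  exact_mod_cast h.resolve_right Complex.two_pi_I_ne_zero

theorem cayleyCochain_mem_singularCocycles :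
    cayleyCochain H ∈ singularCocycles (SelfAdjointGrassmannian H) ℤ := by
  obtain ⟨G, hG⟩ := exists_logVariation_eq_cayleyCochain (H := H)
  intro s
  have h := logVariation_mem_singularCocycles (H := H) s
  have hδ := (singularCoboundary (SelfAdjointGrassmannian H) ℂ G).2 s
  simp only [hG] at h
  change G _ - G _ - (G _ - G _) + (G _ - G _) = 0 at hδ
  have h' : ((cayleyCochain H (s.comp (simplexEdge 1 2)) - cayleyCochain H (s.comp (simplexEdge 0 2))
      + cayleyCochain H (s.comp (simplexEdge 0 1)) : ℤ) : ℂ) * (2 * Real.pi * Complex.I) = 0 := by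
    push_cast
    linear_combination h - hδ
  exact_mod_cast (mul_eq_zero.1 h').resolve_right Complex.two_pi_I_ne_zero

lemma maslovCochain_eq (p : C(I, SelfAdjointGrassmannian H)) :
    maslovCochain H p = (logVariation p).im / (2 * Real.pi) := by
  rw [maslovCochain, argVariation_regDet]

lemma exists_maslovCochain_eq :
    ∃ f : SelfAdjointGrassmannian H → ℝ, ∀ p,
      maslovCochain H p = f (p 1) - f (p 0) + cayleyCochain H p := by
  obtain ⟨G, hG⟩ := exists_logVariation_eq_cayleyCochain (H := H)
  refine ⟨fun U => (G U).im / (2 * Real.pi), fun p => ?_⟩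
  have hpi := Real.pi_ne_zero
  have h : ((cayleyCochain H p : ℂ) * (2 * Real.pi * Complex.I)).im
      = cayleyCochain H p * (2 * Real.pi) := by
    simp
  rw [maslovCochain_eq, hG, Complex.add_im, Complex.sub_im, h]
  field_simp

theorem maslovCochain_mem_singularCocycles :
    maslovCochain H ∈ singularCocycles (SelfAdjointGrassmannian H) ℝ := by
  intro s
  have h := congrArg Complex.im (logVariation_mem_singularCocycles (H := H) s)
  simp only [Complex.add_im, Complex.sub_im, Complex.zero_im] at h
  simp only [maslovCochain_eq]
  rw [← sub_div, ← add_div, h, zero_div]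

lemma cayleyCochain_rotationLoop (U : SelfAdjointGrassmannian H) (v : H) (hv : ‖v‖ = 1) :
    cayleyCochain H (rotationLoop U v hv) = 1 := by
  obtain ⟨G, hG⟩ := exists_logVariation_eq_cayleyCochain (H := H)
  have h := hG (rotationLoop U v hv)
  have h1 : rotationLoop U v hv 1 = rotationLoop U v hv 0 := by simp [rotationLoop]
  rw [h1, sub_self, zero_add, logVariation_rotationLoop, eq_comm,
    mul_eq_right₀ Complex.two_pi_I_ne_zero] at h
  exact_mod_cast h

/-- The class of the Cayley cochain is the Maslov class. -/
theorem map_singularClass_cayleyCochain :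
    SingularH1.map (SelfAdjointGrassmannian H) (Int.castAddHom ℝ)
      (singularClass (cayleyCochain H) cayleyCochain_mem_singularCocycles) =
    singularClass (maslovCochain H) maslovCochain_mem_singularCocycles := by
  obtain ⟨f, hf⟩ := exists_maslovCochain_eq (H := H)
  refine QuotientAddGroup.eq.2 ⟨f, ?_⟩
  ext p
  change f (p 1) - f (p 0) = -(cayleyCochain H p : ℝ) + maslovCochain H p
  rw [hf]
  ring

/-- The class of the Cayley cochain generates the first cohomology. -/
theorem existsUnique_zsmul_singularClass [Nontrivial H]
    (x : SingularH1 (SelfAdjointGrassmannian H) ℤ) :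
    ∃! n : ℤ, x = n • singularClass (cayleyCochain H) cayleyCochain_mem_singularCocycles := by
  obtain ⟨v, hv⟩ := exists_norm_eq H zero_le_one
  induction x using QuotientAddGroup.induction_on with
  | H c =>
    obtain ⟨G, hG, -⟩ := exists_cocycle_eq c.2 fun U w hw =>
      cocycle_rotationLoop c.2 U 1 w v hw hv
    refine ⟨c.1 (rotationLoop 1 v hv), ?_, fun m hm => ?_⟩
    · refine QuotientAddGroup.eq.2 ⟨-G, ?_⟩
      ext p
      change -G (p 1) - -G (p 0) = -c.1 p + c.1 (rotationLoop 1 v hv) * cayleyCochain H p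
      rw [hG p _ (isCrossingNumber_cayleyCochain p), smul_eq_mul]
      ring
    · obtain ⟨f, hf⟩ := QuotientAddGroup.eq.1 hm
      have h := congrArg (fun d => d.1 (rotationLoop 1 v hv)) hf
      change f (rotationLoop 1 v hv 1) - f (rotationLoop 1 v hv 0) =
        -c.1 (rotationLoop 1 v hv) + m * cayleyCochain H (rotationLoop 1 v hv) at h
      have h1 : rotationLoop 1 v hv 1 = rotationLoop 1 v hv 0 := by simp [rotationLoop]
      rw [h1, sub_self, cayleyCochain_rotationLoop] at h
      linarith

/-! ### Closed curves -/

lemma loopPath_one_eq_zero (γ : C(Circle, SelfAdjointGrassmannian H)) :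
    loopPath γ 1 = loopPath γ 0 := by
  simp [loopPath]

lemma isWindingNumber_regDet_iff (γ : C(Circle, SelfAdjointGrassmannian H)) (n : ℤ) :
    IsWindingNumber (fun t => regDet (loopPath γ t)) n ↔ n = cayleyIndex γ := by
  obtain ⟨G, hG⟩ := exists_logVariation_eq_cayleyCochain (H := H)
  have h := hG (loopPath γ)
  rw [loopPath_one_eq_zero, sub_self, zero_add] at h
  constructor
  · rintro ⟨φ, hφ, hn⟩
    rw [logVariation_eq hφ, hn, mul_comm] at h
    exact_mod_cast mul_right_cancel₀ Complex.two_pi_I_ne_zero h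
  · rintro rfl
    obtain ⟨φ, hφ⟩ := exists_isLogLift (loopPath γ)
    exact ⟨φ, hφ, by rw [← logVariation_eq hφ, h, mul_comm]; rfl⟩

/-- The Maslov index of a closed curve is its Cayley index. -/
theorem maslovIndex_eq_cayleyIndex (γ : C(Circle, SelfAdjointGrassmannian H)) :
    maslovIndex γ = cayleyIndex γ := by
  have h : ∃ n, IsWindingNumber (fun t => regDet (loopPath γ t)) n :=
    ⟨_, (isWindingNumber_regDet_iff γ _).2 rfl⟩
  rw [maslovIndex, windingNumber, dif_pos h]
  exact (isWindingNumber_regDet_iff γ _).1 h.choose_spec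

end SelfAdjointGrassmannian

/-! ### Local crossing indices -/

/-- A function on the line that is constant in a punctured neighbourhood of each point, with a
period up to an increment, has increment `0`. -/
lemma eq_zero_of_eventuallyEq_punctured {E : ℝ → ℤ} {T : ℝ} {d : ℤ}
    (hE : ∀ t, ∃ v, ∀ᶠ s in 𝓝[≠] t, E s = v) (hT : ∀ t, E (t + T) = E t + d) : d = 0 := by
  choose v hv using hE
  have hloc : IsLocallyConstant v := by
    refine (IsLocallyConstant.iff_eventually_eq v).2 fun t => ?_
    have h1 := eventually_eventually_nhdsWithin.2 (hv t)
    rw [eventually_nhdsWithin_iff] at h1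
    filter_upwards [h1] with s hs
    rcases eq_or_ne s t with rfl | hst
    · rfl
    · have h2 : ∀ᶠ r in 𝓝[≠] s, E r = v t := by
        have h3 : ({t}ᶜ : Set ℝ) ∈ 𝓝 s := isOpen_compl_singleton.mem_nhds hst
        have h4 := hs hst
        rw [nhdsWithin_eq_nhds.2 h3] at h4
        exact h4.filter_mono nhdsWithin_le_nhds
      obtain ⟨r, hr, hr'⟩ := ((hv s).and h2).exists
      exact hr.symm.trans hr'
  have hconst : v (0 + T) = v 0 := by
    exact hloc.apply_eq_of_isPreconnected isPreconnected_univ trivial trivial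
  have h1 : ∀ᶠ s in 𝓝[≠] (0 : ℝ), E (s + T) = v (0 + T) := by
    have : Tendsto (fun s => s + T) (𝓝[≠] 0) (𝓝[≠] (0 + T)) := by
      refine tendsto_nhdsWithin_iff.2 ⟨?_, ?_⟩
      · exact ((continuous_id.add continuous_const).tendsto 0).mono_left nhdsWithin_le_nhds
      · filter_upwards [self_mem_nhdsWithin] with s hs
        simpa using hs
    exact this.eventually (hv (0 + T))
  obtain ⟨s, h2, h3⟩ := ((hv 0).and h1).exists
  rw [hT, h2, hconst] at h3
  linarith

namespace SelfAdjointGrassmannian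

variable {H : Type u} [NormedAddCommGroup H] [InnerProductSpace ℂ H] [CompleteSpace H]

/-- The closed curve `γ`, as a periodic curve on the real line. -/
noncomputable def circleCurve (γ : C(Circle, SelfAdjointGrassmannian H)) :
    C(ℝ, SelfAdjointGrassmannian H) := ⟨fun t => γ (Circle.exp t), by fun_prop⟩

lemma curveSegment_apply_mem {X : Type*} [TopologicalSpace X] (P : C(ℝ, X)) {a b : ℝ} (hab : a ≤ b)
    {Q : X → Prop} (h : ∀ s ∈ Set.Icc a b, Q (P s)) (t : I) : Q (curveSegment P a b t) := by
  refine h ((1 - (t : ℝ)) • a + (t : ℝ) • b) ?_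
  have h0 := t.2.1
  have h1 := t.2.2
  simp only [smul_eq_mul]
  constructor <;> nlinarith

/-- The Cayley index of `γ` over the oriented interval from `0` to `t`, where `t` may be negative or
beyond `2π`. -/
noncomputable def crossingCount (γ : C(Circle, SelfAdjointGrassmannian H)) (t : ℝ) : ℤ :=
  cayleyCochain H (curveSegment (circleCurve γ) 0 t)

lemma crossingCount_sub (γ : C(Circle, SelfAdjointGrassmannian H)) (s r : ℝ) :
    crossingCount γ r - crossingCount γ s =
      cayleyCochain H (curveSegment (circleCurve γ) s r) := by
  rw [crossingCount, crossingCount,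
    ← cocycle_segment_add cayleyCochain_mem_singularCocycles (circleCurve γ) 0 s r,
    add_sub_cancel_left]

lemma crossingCount_eq {γ : C(Circle, SelfAdjointGrassmannian H)} {s r : ℝ} (hsr : s ≤ r)
    (h : ∀ t ∈ Set.Icc s r, γ (Circle.exp t) ∉ cayleySubmanifold H) :
    crossingCount γ r = crossingCount γ s := by
  rw [← sub_eq_zero, crossingCount_sub]
  exact cayleyCochain_eq_zero
    (curveSegment_apply_mem (circleCurve γ) hsr (Q := fun U => U ∉ cayleySubmanifold H) h)

/-- Over an interval on which the end points of one arc are not in the spectrum, a single step of the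
partition computes the Cayley index. -/
lemma crossingCount_sub_eq_arcCount {γ : C(Circle, SelfAdjointGrassmannian H)} {s r ε : ℝ}
    (hsr : s ≤ r) (h0 : 0 < ε) (h1 : ε < Real.pi)
    (h : ∀ t ∈ Set.Icc s r, (Circle.exp (Real.pi + ε) : ℂ) ∉ spectrum ℂ (γ (Circle.exp t)).op ∧
      (Circle.exp (Real.pi - ε) : ℂ) ∉ spectrum ℂ (γ (Circle.exp t)).op) :
    crossingCount γ r - crossingCount γ s =
      (arcCount (γ (Circle.exp r)) ε : ℤ) - arcCount (γ (Circle.exp s)) ε := by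
  rw [crossingCount_sub, eq_comm, ← isCrossingNumber_iff]
  refine ⟨1, fun j => if j = 0 then 0 else 1, fun _ => ε, ?_, by simp, by simp, ?_, ?_⟩
  · refine monotone_nat_of_le_succ fun j => ?_
    simp only [Nat.add_eq_zero_iff, one_ne_zero, and_false, if_false]
    exact unitInterval.le_one'
  · intro j _
    exact ⟨h0, h1, fun t _ => curveSegment_apply_mem (circleCurve γ) hsr (Q := fun U =>
      (Circle.exp (Real.pi + ε) : ℂ) ∉ spectrum ℂ U.op ∧
      (Circle.exp (Real.pi - ε) : ℂ) ∉ spectrum ℂ U.op) h t⟩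
  · simp [curveSegment, circleCurve]

lemma crossingCount_add_two_pi (γ : C(Circle, SelfAdjointGrassmannian H)) (t : ℝ) :
    crossingCount γ (t + 2 * Real.pi) = crossingCount γ t + cayleyIndex γ := by
  have h1 : curveSegment (circleCurve γ) 0 (2 * Real.pi) = loopPath γ := by
    ext s
    simp [curveSegment, circleCurve, loopPath, mul_comm]
  have h2 : curveSegment (circleCurve γ) (2 * Real.pi) (t + 2 * Real.pi) =
      curveSegment (circleCurve γ) 0 t := by
    ext s
    simp only [curveSegment, circleCurve, ContinuousMap.comp_apply, ContinuousMap.coe_mk,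
      smul_eq_mul]
    have : (1 - (s : ℝ)) * (2 * Real.pi) + s * (t + 2 * Real.pi) =
        ((1 - (s : ℝ)) * 0 + s * t) + 2 * Real.pi := by ring
    rw [this, Circle.exp_add_two_pi]
  have h3 := crossingCount_sub γ (2 * Real.pi) (t + 2 * Real.pi)
  have h4 : crossingCount γ (2 * Real.pi) = cayleyIndex γ := by rw [crossingCount, h1]; rfl
  rw [h2, h4] at h3
  change _ - _ = crossingCount γ t at h3
  linarith

lemma crossingCount_add_int_mul (γ : C(Circle, SelfAdjointGrassmannian H)) (t : ℝ) (k : ℤ) :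
    crossingCount γ (t + k * (2 * Real.pi)) = crossingCount γ t + k * cayleyIndex γ := by
  induction k using Int.induction_on with
  | zero => simp
  | succ k ih =>
    have : t + ((k + 1 : ℤ) : ℝ) * (2 * Real.pi) = t + (k : ℤ) * (2 * Real.pi) + 2 * Real.pi := by
      push_cast; ring
    rw [this, crossingCount_add_two_pi, ih]
    ring
  | pred k ih =>
    have : t + ((-k : ℤ) : ℝ) * (2 * Real.pi) =
        t + ((-k - 1 : ℤ) : ℝ) * (2 * Real.pi) + 2 * Real.pi := by
      push_cast; ring
    rw [this, crossingCount_add_two_pi] at ih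
    linear_combination ih

section FiniteCrossings

variable {γ : C(Circle, SelfAdjointGrassmannian H)} {S : Finset ℝ}
  (hS : ∀ θ : ℝ, θ ∈ S ↔ θ ∈ Set.Ico 0 (2 * Real.pi) ∧ γ (Circle.exp θ) ∈ cayleySubmanifold H)

include hS

lemma exists_mem_of_mem_cayleySubmanifold {t : ℝ}
    (ht : γ (Circle.exp t) ∈ cayleySubmanifold H) : ∃ x ∈ S, ∃ k : ℤ, t = x + k * (2 * Real.pi) := by
  obtain ⟨hmem, hk⟩ := And.intro (toIcoMod_mem_Ico' Real.two_pi_pos t)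
    (self_sub_toIcoMod Real.two_pi_pos 0 t)
  have hk' : t = toIcoMod Real.two_pi_pos 0 t + toIcoDiv Real.two_pi_pos 0 t * (2 * Real.pi) := by
    rw [zsmul_eq_mul] at hk
    linarith
  refine ⟨toIcoMod Real.two_pi_pos 0 t, (hS _).2 ⟨hmem, ?_⟩, toIcoDiv Real.two_pi_pos 0 t, hk'⟩
  have : Circle.exp (toIcoMod Real.two_pi_pos 0 t) = Circle.exp t :=
    Circle.exp_eq_exp.2 ⟨-toIcoDiv Real.two_pi_pos 0 t, by push_cast; linarith⟩
  rwa [this]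

/-- The crossings are isolated. -/
lemma eventually_notMem_cayleySubmanifold (t₀ : ℝ) :
    ∀ᶠ t in 𝓝[≠] t₀, γ (Circle.exp t) ∉ cayleySubmanifold H := by
  have hpi := Real.pi_gt_three
  have hfin : {t ∈ Set.Ioo (t₀ - 1) (t₀ + 1) | t ≠ t₀ ∧
      γ (Circle.exp t) ∈ cayleySubmanifold H}.Finite := by
    refine Set.Finite.of_finite_image (f := fun t => Circle.exp t)
      ((S.finite_toSet.image fun t => Circle.exp t).subset ?_) ?_
    · rintro _ ⟨t, ⟨-, -, ht⟩, rfl⟩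
      obtain ⟨x, hx, k, rfl⟩ := exists_mem_of_mem_cayleySubmanifold hS ht
      exact ⟨x, hx, Circle.exp_eq_exp.2 ⟨-k, by push_cast; ring⟩⟩
    · rintro a ⟨ha, -⟩ b ⟨hb, -⟩ hab
      rcases lt_trichotomy a b with h | h | h
      · exact absurd hab.symm (Circle.exp_ne_exp (by linarith) (by linarith [ha.1, hb.2]))
      · exact h
      · exact absurd hab (Circle.exp_ne_exp (by linarith) (by linarith [hb.1, ha.2]))
  have h1 := hfin.isClosed.isOpen_compl.mem_nhds (x := t₀) (by simp)
  have h2 : Set.Ioo (t₀ - 1) (t₀ + 1) ∈ 𝓝 t₀ := Ioo_mem_nhds (by linarith) (by linarith)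
  filter_upwards [self_mem_nhdsWithin, nhdsWithin_le_nhds h1, nhdsWithin_le_nhds h2]
    with t h h' h'' hmem
  exact h' ⟨h'', h, hmem⟩

/-- The crossing count is constant shortly before and shortly after each parameter value. -/
lemma exists_crossingCount_eq (t₀ : ℝ) :
    ∃ a b : ℤ, (∀ᶠ s in 𝓝[<] t₀, crossingCount γ s = a) ∧
      (∀ᶠ r in 𝓝[>] t₀, crossingCount γ r = b) ∧
      (γ (Circle.exp t₀) ∉ cayleySubmanifold H → a = b) := by
  obtain ⟨δ, hδ, hsub⟩ := Metric.mem_nhdsWithin_iff.1 (eventually_notMem_cayleySubmanifold hS t₀)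
  have hno : ∀ t, |t - t₀| < δ → t ≠ t₀ → γ (Circle.exp t) ∉ cayleySubmanifold H :=
    fun t ht hne => hsub ⟨by simpa [Real.dist_eq] using ht, hne⟩
  refine ⟨crossingCount γ (t₀ - δ / 2), crossingCount γ (t₀ + δ / 2), ?_, ?_, fun h => ?_⟩
  · filter_upwards [Ioo_mem_nhdsLT (show t₀ - δ / 2 < t₀ by linarith)] with s hs
    refine crossingCount_eq hs.1.le fun t ht => hno t ?_ ?_
    · rw [abs_lt]; constructor <;> linarith [ht.1, ht.2, hs.1, hs.2]
    · exact (ht.2.trans_lt hs.2).ne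
  · filter_upwards [Ioo_mem_nhdsGT (show t₀ < t₀ + δ / 2 by linarith)] with r hr
    refine (crossingCount_eq hr.2.le fun t ht => hno t ?_ ?_).symm
    · rw [abs_lt]; constructor <;> linarith [ht.1, ht.2, hr.1, hr.2]
    · exact (hr.1.trans_le ht.1).ne'
  · refine (crossingCount_eq (by linarith) fun t ht => ?_).symm
    rcases eq_or_ne t t₀ with rfl | hne
    · exact h
    · refine hno t ?_ hne
      rw [abs_lt]; constructor <;> linarith [ht.1, ht.2]

omit hS in
/-- Shortly before and after a parameter value, the crossing count and the number of eigenvalues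
just past `-1` change by the same amount. -/
lemma eventually_arcCount_sub (γ : C(Circle, SelfAdjointGrassmannian H)) (t₀ : ℝ) :
    ∀ᶠ ε in 𝓝[>] (0 : ℝ), ∀ᶠ s in 𝓝[<] t₀, ∀ᶠ r in 𝓝[>] t₀,
      (arcCount (γ (Circle.exp r)) ε : ℤ) - (arcCount (γ (Circle.exp s)) ε : ℤ) =
        crossingCount γ r - crossingCount γ s := by
  filter_upwards [(γ (Circle.exp t₀)).eventually_isCut_pair, Ioo_mem_nhdsGT Real.pi_pos]
    with ε hcut hε
  have hopen : ∀ w : ℂ, w ∉ spectrum ℂ (γ (Circle.exp t₀)).op →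
      ∀ᶠ t in 𝓝 t₀, w ∉ spectrum ℂ (γ (Circle.exp t)).op := fun w hw =>
    ((isOpen_setOf_notMem_spectrum w).preimage (circleCurve γ).continuous).mem_nhds hw
  obtain ⟨δ, hδ, hsub⟩ := Metric.mem_nhds_iff.1
    ((hopen _ hcut.1.notMem).and (hopen _ hcut.2.notMem))
  filter_upwards [Ioo_mem_nhdsLT (show t₀ - δ < t₀ by linarith)] with s hs
  filter_upwards [Ioo_mem_nhdsGT (show t₀ < t₀ + δ by linarith)] with r hr
  refine (crossingCount_sub_eq_arcCount (hs.2.trans hr.1).le hε.1 hε.2 fun t ht => ?_).symm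
  refine hsub ?_
  rw [Metric.mem_ball, Real.dist_eq, abs_lt]
  constructor <;> linarith [ht.1, ht.2, hs.1, hr.2]

/-- With finitely many crossings, the Cayley index is the sum of the local crossing indices. -/
theorem exists_localCrossingIndex :
    ∃ m : ℝ → ℤ, (∀ θ ∈ S, ∀ k : ℤ, IsLocalCrossingIndex γ θ k ↔ k = m θ) ∧
      cayleyIndex γ = ∑ θ ∈ S, m θ := by
  choose a b ha hb hab using exists_crossingCount_eq hS
  have hpi := Real.two_pi_pos
  have hloc : ∀ t₀, IsLocalCrossingIndex γ t₀ (b t₀ - a t₀) := by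
    intro t₀
    filter_upwards [eventually_arcCount_sub γ t₀] with ε hε
    filter_upwards [hε, ha t₀] with s hs has
    filter_upwards [hs, hb t₀] with r hr hbr
    rw [hr, hbr, has]
  refine ⟨fun t => b t - a t, fun θ _ k => ⟨fun hk => ?_, fun hk => hk ▸ hloc θ⟩, ?_⟩
  · obtain ⟨ε, h1, h2⟩ := (hk.and (hloc θ)).exists
    obtain ⟨s, h3, h4⟩ := (h1.and h2).exists
    obtain ⟨r, h5, h6⟩ := (h3.and h4).exists
    exact h5.symm.trans h6
  -- subtract from the crossing count a step function with the same jumps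
  rw [← sub_eq_zero]
  refine eq_zero_of_eventuallyEq_punctured (T := 2 * Real.pi)
    (E := fun t => crossingCount γ t - ∑ x ∈ S, (b x - a x) * ⌈(t - x) / (2 * Real.pi)⌉) ?_ ?_
  · intro t₀
    have hl : ∀ᶠ t in 𝓝[<] t₀, ∀ x ∈ S,
        ⌈(t - x) / (2 * Real.pi)⌉ = ⌈(t₀ - x) / (2 * Real.pi)⌉ := by
      refine (eventually_all_finset S).2 fun x _ => ?_
      have h1 : Tendsto (fun t => (t - x) / (2 * Real.pi)) (𝓝[<] t₀)
          (𝓝[≤] ((t₀ - x) / (2 * Real.pi))) := by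
        refine tendsto_nhdsWithin_iff.2 ⟨?_, ?_⟩
        · exact ((continuous_id.sub continuous_const).div_const _).continuousAt.tendsto.mono_left
            nhdsWithin_le_nhds
        · filter_upwards [self_mem_nhdsWithin] with t ht
          have : t < t₀ := ht
          simp only [Set.mem_Iic]
          gcongr
      exact tendsto_pure.1 ((tendsto_ceil_left_pure_ceil _).comp h1)
    have hr : ∀ᶠ t in 𝓝[>] t₀, ∀ x ∈ S,
        ⌈(t - x) / (2 * Real.pi)⌉ = ⌊(t₀ - x) / (2 * Real.pi)⌋ + 1 := by
      refine (eventually_all_finset S).2 fun x _ => ?_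
      have h1 : Tendsto (fun t => (t - x) / (2 * Real.pi)) (𝓝[>] t₀)
          (𝓝[>] ((t₀ - x) / (2 * Real.pi))) := by
        refine tendsto_nhdsWithin_iff.2 ⟨?_, ?_⟩
        · exact ((continuous_id.sub continuous_const).div_const _).continuousAt.tendsto.mono_left
            nhdsWithin_le_nhds
        · filter_upwards [self_mem_nhdsWithin] with t ht
          have : t₀ < t := ht
          simp only [Set.mem_Ioi]
          gcongr
      exact tendsto_pure.1 ((tendsto_ceil_right_pure_floor_add_one _).comp h1)
    have hjump : b t₀ - a t₀ = ∑ x ∈ S, (b x - a x) *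
        (⌊(t₀ - x) / (2 * Real.pi)⌋ + 1 - ⌈(t₀ - x) / (2 * Real.pi)⌉) := by
      have hnon : ∀ x, (∀ k : ℤ, t₀ ≠ x + k * (2 * Real.pi)) →
          ⌊(t₀ - x) / (2 * Real.pi)⌋ + 1 - ⌈(t₀ - x) / (2 * Real.pi)⌉ = 0 := by
        intro x hx
        rw [sub_eq_zero, eq_comm, Int.ceil_eq_floor_add_one_iff_notMem]
        rintro ⟨k, hk⟩
        rw [eq_div_iff hpi.ne'] at hk
        exact hx k (by linarith)
      by_cases hmem : γ (Circle.exp t₀) ∈ cayleySubmanifold H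
      · obtain ⟨x₀, hx₀, k, hk⟩ := exists_mem_of_mem_cayleySubmanifold hS hmem
        rw [Finset.sum_eq_single_of_mem x₀ hx₀]
        · have h1 : (t₀ - x₀) / (2 * Real.pi) = k := by
            rw [hk]; field_simp; ring
          rw [h1, Int.floor_intCast, Int.ceil_intCast, add_sub_cancel_left, mul_one]
          -- the one-sided values at `t₀` and at `x₀` differ by `k` times the period increment
          have h2 : Tendsto (fun t : ℝ => t + k * (2 * Real.pi)) (𝓝[<] x₀) (𝓝[<] t₀) := by
            refine tendsto_nhdsWithin_iff.2 ⟨?_, ?_⟩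
            · rw [hk]
              exact ((continuous_id.add continuous_const).tendsto x₀).mono_left nhdsWithin_le_nhds
            · filter_upwards [self_mem_nhdsWithin] with t ht
              have : t < x₀ := ht
              simp only [Set.mem_Iio]
              linarith
          have h3 : Tendsto (fun t : ℝ => t + k * (2 * Real.pi)) (𝓝[>] x₀) (𝓝[>] t₀) := by
            refine tendsto_nhdsWithin_iff.2 ⟨?_, ?_⟩
            · rw [hk]
              exact ((continuous_id.add continuous_const).tendsto x₀).mono_left nhdsWithin_le_nhds
            · filter_upwards [self_mem_nhdsWithin] with t ht
              have : x₀ < t := ht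
              simp only [Set.mem_Ioi]
              linarith
          obtain ⟨s, hs, hs'⟩ := ((h2.eventually (ha t₀)).and (ha x₀)).exists
          obtain ⟨r, hr, hr'⟩ := ((h3.eventually (hb t₀)).and (hb x₀)).exists
          rw [crossingCount_add_int_mul] at hs hr
          linarith
        · intro x hx hne
          rw [hnon x, mul_zero]
          intro k' hk'
          have h1 := ((hS x).1 hx).1
          have h2 := ((hS x₀).1 hx₀).1
          have h3 : Circle.exp x = Circle.exp x₀ :=
            Circle.exp_eq_exp.2 ⟨k - k', by push_cast; linarith⟩
          rcases lt_or_gt_of_ne hne with h | h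
          · exact Circle.exp_ne_exp (by linarith) (by linarith [h1.1, h2.2]) h3.symm
          · exact Circle.exp_ne_exp (by linarith) (by linarith [h2.1, h1.2]) h3
      · rw [hab t₀ hmem, sub_self, Finset.sum_eq_zero]
        intro x hx
        rw [hnon x, mul_zero]
        rintro k hk
        have h3 : Circle.exp t₀ = Circle.exp x := Circle.exp_eq_exp.2 ⟨k, hk⟩
        exact hmem (h3 ▸ ((hS x).1 hx).2)
    refine ⟨a t₀ - ∑ x ∈ S, (b x - a x) * ⌈(t₀ - x) / (2 * Real.pi)⌉, ?_⟩
    rw [← Set.Iio_union_Ioi, nhdsWithin_union, eventually_sup]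
    constructor
    · filter_upwards [ha t₀, hl] with t h1 h2
      rw [h1]
      congr 1
      exact Finset.sum_congr rfl fun x hx => by rw [h2 x hx]
    · filter_upwards [hb t₀, hr] with t h1 h2
      rw [h1, Finset.sum_congr rfl fun x hx => by rw [h2 x hx]]
      simp only [mul_sub, Finset.sum_sub_distrib] at hjump
      linarith
  · intro t
    have h1 : ∀ x, ⌈(t + 2 * Real.pi - x) / (2 * Real.pi)⌉ = ⌈(t - x) / (2 * Real.pi)⌉ + 1 := by
      intro x
      rw [← Int.ceil_add_one]
      congr 1
      field_simp
      ring
    simp only [h1, crossingCount_add_two_pi, mul_add, Finset.sum_add_distrib, mul_one]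
    ring

end FiniteCrossings

end SelfAdjointGrassmannian

theorem mainTheorem5 {H : Type*} [NormedAddCommGroup H] [InnerProductSpace ℂ H] [CompleteSpace H]
    [Nontrivial H] :
    -- the product that defines the regularized determinant converges
    (∀ U : SelfAdjointGrassmannian H, Multipliable (regDetFactor U)) ∧
    -- along any curve the regularized determinant has a continuous logarithm, and the signed
    -- number of crossings through `-1` is well defined
    (∀ p : C(I, SelfAdjointGrassmannian H),
      (∃ φ : C(I, ℂ), IsLogLift (fun t => regDet (p t)) φ) ∧
      (∀ n : ℤ, IsCrossingNumber p n ↔ n = cayleyCochain H p)) ∧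
    -- for a closed curve the Maslov index is well defined and equals the Cayley index
    (∀ γ : C(Circle, SelfAdjointGrassmannian H),
      (∀ n : ℤ, IsWindingNumber (fun t => regDet (loopPath γ t)) n ↔ n = maslovIndex γ) ∧
      maslovIndex γ = cayleyIndex γ ∧
      -- if there are finitely many crossings, the index is the sum of their local indices
      (∀ S : Finset ℝ,
        (∀ θ : ℝ, θ ∈ S ↔
          θ ∈ Set.Ico 0 (2 * Real.pi) ∧ γ (Circle.exp θ) ∈ cayleySubmanifold H) →
        ∃ m : ℝ → ℤ, (∀ θ ∈ S, ∀ k : ℤ, IsLocalCrossingIndex γ θ k ↔ k = m θ) ∧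
          cayleyIndex γ = ∑ θ ∈ S, m θ)) ∧
    -- the class dual to the Cayley submanifold is the Maslov class and generates `H¹ ≅ ℤ`
    (∃ (hα : maslovCochain H ∈ singularCocycles (SelfAdjointGrassmannian H) ℝ)
      (hc : cayleyCochain H ∈ singularCocycles (SelfAdjointGrassmannian H) ℤ),
      SingularH1.map (SelfAdjointGrassmannian H) (Int.castAddHom ℝ)
          (singularClass (cayleyCochain H) hc) =
        singularClass (maslovCochain H) hα ∧
      ∀ x : SingularH1 (SelfAdjointGrassmannian H) ℤ,
        ∃! n : ℤ, x = n • singularClass (cayleyCochain H) hc) := by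
  exact ⟨SelfAdjointGrassmannian.multipliable_regDetFactor,
    fun p => ⟨SelfAdjointGrassmannian.exists_isLogLift p,
      SelfAdjointGrassmannian.isCrossingNumber_iff p⟩,
    fun γ => ⟨fun n => by
        rw [SelfAdjointGrassmannian.maslovIndex_eq_cayleyIndex]
        exact SelfAdjointGrassmannian.isWindingNumber_regDet_iff γ n,
      SelfAdjointGrassmannian.maslovIndex_eq_cayleyIndex γ,
      fun _ hS => SelfAdjointGrassmannian.exists_localCrossingIndex hS⟩,
    SelfAdjointGrassmannian.maslovCochain_mem_singularCocycles,
    SelfAdjointGrassmannian.cayleyCochain_mem_singularCocycles,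
    SelfAdjointGrassmannian.map_singularClass_cayleyCochain,
    SelfAdjointGrassmannian.existsUnique_zsmul_singularClass⟩
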